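/- Theorem 4.6. Work in the hyperbolic plane of curvature $-1$, in the Klein model (the open unit disk). For $0<a<1$ let $\mathcal F_a$ be the Lambert quadrilateral with vertices $A_0=(0,1)$ (ideal), $A_1=(0,0)$, $P_1=(a,0)$, $P_0=(a,1-a^2)$; it is the fundamental domain of the Coxeter tiling $\mathcal T_a$ with symbol $[\infty]$. For $0\le y_1,y_2<1$ let $\mathfrak H(y_1)$ be the closed horoball centred at $A_0$ whose boundary horocycle passes through $(0,y_1)$, and let $\mathcal H_a(y_2)$ be the closed hyperball (the set of points at distance at most some $h\ge 0$ from the line $A_1P_1$) whose boundary hypercycle passes through $(0,y_2)$; for $y_2=0$ it degenerates to the line. They form a hyp-hor packing $\mathcal P_a(y_1,y_2)$ if $\mathfrak H(y_1)$ is disjoint from the open segments $A_1P_1$ and $P_0P_1$, $\mathcal H_a(y_2)$ is disjoint from the open segment $A_0P_0$, and the interiors of $\mathfrak H(y_1)$ and $\mathcal H_a(y_2)$ are disjoint. Its density is $$\delta(\mathcal P_a(y_1,y_2))=\frac{\operatorname{Vol}\big(\mathcal F_a\cap(\mathfrak H(y_1)\cup\mathcal H_a(y_2))\big)}{\operatorname{Vol}(\mathcal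 F_a)},$$ where $\operatorname{Vol}$ is hyperbolic area. A packing with $y_1=y_2=y$ (the two curves touch at $(0,y)$) is of main type $\mathcal P^1_a$ if its hypercycle contains $P_0$, and of main type $\mathcal P^2_a$ if its horocycle contains $P_0$. Then: 1. A packing of type $\mathcal P^1_a$ exists for every $0<a<1$, exactly for $y=\sqrt{1-a^2}$; a packing of type $\mathcal P^2_a$ exists if and only if $0<a\le 1/\sqrt2$, exactly for $y=1-2a^2$. 2. For every $a\in(0,1)$, each hyp-hor packing with parameter $a$ that is not of one of the two main types has density strictly smaller than some packing of main type with the same parameter $a$. 3. Every hyp-hor packing has density $<3/\pi$; moreover, for every $\varepsilon>0$ there is $\eta>0$ such that every hyp-hor packing with parameter $a\ge\varepsilon$ has density at most $3/\pi-\eta$. So densities can approach $3/\pi$ only as $a\to0$. 4. $\lim_{a\to0^+}\delta(\mathcal P^1_a)=\lim_{a\to0^+}\delta(\mathcal P^2_a)=3/\pi$, so both main types approximate arbitrarily closely the number $3/\pi$, the supremum of the densities of all hyp-hor packings considered here. -/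

import Mathlib

open Set Filter Topology MeasureTheory

noncomputable section

namespace HypHor

/-- The hyperbolic plane (curvature `-1`) in the Beltrami–Cayley–Klein model: the open unit disk.
A projective point `(1, x, y)` is written `(x, y)`. -/
def kleinDisk : Set (ℝ × ℝ) := {p | p.1 ^ 2 + p.2 ^ 2 < 1}

/-- The hyperbolic distance of two points of the Klein disk:
`cosh d = -⟨p, q⟩ / √(⟨p, p⟩ ⟨q, q⟩)` with `⟨p, q⟩ = -1 + p₁ q₁ + p₂ q₂`. -/
def kleinDist (p q : ℝ × ℝ) : ℝ :=
  Real.arcosh ((1 - p.1 * q.1 - p.2 * q.2) /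
    Real.sqrt ((1 - p.1 ^ 2 - p.2 ^ 2) * (1 - q.1 ^ 2 - q.2 ^ 2)))

/-- The hyperbolic area measure: in Klein coordinates the area element of curvature `-1` is
`dx dy / (1 - x² - y²)^(3/2)`. -/
def area : Measure (ℝ × ℝ) :=
  (volume.restrict kleinDisk).withDensity
    (fun p => ENNReal.ofReal (1 / (1 - p.1 ^ 2 - p.2 ^ 2) ^ (3 / 2 : ℝ)))

/-- The hyperbolic straight line through `p` and `q`: the chord of the disk. -/
def kleinLine (p q : ℝ × ℝ) : Set (ℝ × ℝ) := kleinDisk ∩ affineSpan ℝ {p, q}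

/-- The hyperbolic distance of a point from a set. -/
def distTo (l : Set (ℝ × ℝ)) (p : ℝ × ℝ) : ℝ := ⨅ q : l, kleinDist p q

/-! ### The Lambert quadrilateral -/

/-- The ideal vertex `A₀`. -/
def A0 : ℝ × ℝ := (0, 1)

/-- The vertex `A₁`. -/
def A1 : ℝ × ℝ := (0, 0)

/-- The vertex `P₁`, on the polar line `x = a` of the outer vertex `A₂ = (1/a, 0)`. -/
def P1 (a : ℝ) : ℝ × ℝ := (a, 0)

/-- The vertex `P₀`, the intersection of `A₀A₂` with the polar line `x = a` of `A₂`. -/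
def P0 (a : ℝ) : ℝ × ℝ := (a, 1 - a ^ 2)

/-- The fundamental domain of the tiling: the Lambert quadrilateral `A₀A₁P₁P₀` (Klein segments
are Euclidean segments, so it is the Euclidean convex hull of the vertices without the ideal
vertex `A₀`). -/
def fundDomain (a : ℝ) : Set (ℝ × ℝ) := kleinDisk ∩ convexHull ℝ {A0, A1, P1 a, P0 a}

/-- The point `T` with coordinate `y` on the side `A₁A₀`. -/
def T (y : ℝ) : ℝ × ℝ := (0, y)

/-- The horocycle with centre `A₀ = (0, 1)` through `T s`, given by the equation
`(s - 1)(-1 + x² + y²) - (1 + s)(1 - y)² = 0`. -/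
def horocycle (s : ℝ) : Set (ℝ × ℝ) :=
  {p ∈ kleinDisk | (s - 1) * (-1 + p.1 ^ 2 + p.2 ^ 2) - (1 + s) * (1 - p.2) ^ 2 = 0}

/-- The horoball (disk bounded by the horocycle) with centre `A₀` through `T s`. -/
def horoball (s : ℝ) : Set (ℝ × ℝ) :=
  {p ∈ kleinDisk | 0 ≤ (s - 1) * (-1 + p.1 ^ 2 + p.2 ^ 2) - (1 + s) * (1 - p.2) ^ 2}

/-- The hypercycle with base line `A₁P₁` through `T s`: the points at the same distance from the
base line as `T s` (in both half-planes). -/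
def hypercycle (a s : ℝ) : Set (ℝ × ℝ) :=
  {p ∈ kleinDisk | distTo (kleinLine A1 (P1 a)) p = distTo (kleinLine A1 (P1 a)) (T s)}

/-- The hyperball (strip bounded by the hypercycle) with base line `A₁P₁` through `T s`. -/
def hyperball (a s : ℝ) : Set (ℝ × ℝ) :=
  {p ∈ kleinDisk | distTo (kleinLine A1 (P1 a)) p ≤ distTo (kleinLine A1 (P1 a)) (T s)}

/-- The requirements for a hyp-hor packing with parameter `a`, horocycle through `T y₁` and
hypercycle through `T y₂`. For `y₂ = 0` the strip degenerates to its base line and the packing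
consists of horoballs only. -/
structure IsPacking (a y₁ y₂ : ℝ) : Prop where
  a_pos : 0 < a
  a_lt_one : a < 1
  y₁_nonneg : 0 ≤ y₁
  y₁_lt_one : y₁ < 1
  y₂_nonneg : 0 ≤ y₂
  y₂_lt_one : y₂ < 1
  horo_A1P1 : Disjoint (horoball y₁) (openSegment ℝ A1 (P1 a))
  horo_P0P1 : Disjoint (horoball y₁) (openSegment ℝ (P0 a) (P1 a))
  hyper_A0P0 : Disjoint (hyperball a y₂) (openSegment ℝ A0 (P0 a))
  interiors : Disjoint (interior (horoball y₁)) (interior (hyperball a y₂))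

/-- The density of the packing with parameters `a, y₁, y₂`, with respect to the fundamental
domain. -/
def density (a y₁ y₂ : ℝ) : ℝ :=
  (area (fundDomain a ∩ (horoball y₁ ∪ hyperball a y₂))).toReal / (area (fundDomain a)).toReal

/-- Main type 1: the horocycle and the hypercycle touch at `T y`, and the hypercycle contains
`P₀`. -/
def IsType1 (a y : ℝ) : Prop := IsPacking a y y ∧ P0 a ∈ hypercycle a y

/-- Main type 2: the horocycle and the hypercycle touch at `T y`, and the horocycle contains
`P₀`. -/
def IsType2 (a y : ℝ) : Prop := IsPacking a y y ∧ P0 a ∈ horocycle y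

end HypHor

end

noncomputable section

namespace HypHor

/-! Everything reduces to one real variable. In Klein coordinates the hyperball is the elliptic
region y² ≤ s²(1 − x²), the horoball is also cut out by a quadratic inequality, and the line y = s
separates the two when they touch at `T s`. The packing conditions become 1 − 2a² ≤ y₁, y₂² ≤ 1 − a²
and y₂ ≤ y₁ (`isPacking_iff`); equality in the first or second puts P₀ on the horocycle or the
hypercycle. The domain has area π/2. The horoball covers (1/a)/r, with r = `expDist y₁`, because in
the upper half-plane it is a half-strip of width 1/a. The hyperball covers artanh a · sinh h, where
h is the distance from A₁ to `T y₂`. Enlarging either part increases the area, so touching packings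
suffice. For these the area is p/r + qr with q > 0, which has no interior maximum
(`lt_left_or_lt_right`). The endpoints of the range of y are the main types, except that for 2a² > 1
the lower one is y = 0, where type 1 is still better (`coveredArea_zero_lt_type1`). At both main
types the estimate artanh x · (1 − x²) ≤ x − 2x³/3 bounds the covered area by 3/2 − a²/24. Dividing
by π/2 gives both the strict bound 3/π and the uniform gap; elementary lower bounds tending to 3/2
give the limits. -/

/-! ### Hyperballs and horoballs in Klein coordinates -/

lemma mem_kleinLine_axis {a : ℝ} (ha : a ≠ 0) (p : ℝ × ℝ) :
    p ∈ kleinLine A1 (P1 a) ↔ p.2 = 0 ∧ p.1 ^ 2 < 1 := by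
  obtain ⟨x, y⟩ := p
  simp only [kleinLine, kleinDisk, A1, P1, mem_inter_iff, mem_ofPred_eq, SetLike.mem_coe,
    mem_affineSpan_pair_iff_exists_lineMap_eq]
  constructor
  · rintro ⟨h, r, hr⟩
    simp only [AffineMap.lineMap_apply, vsub_eq_sub, vadd_eq_add, Prod.ext_iff, Prod.smul_mk,
      Prod.mk_sub_mk, Prod.mk_add_mk, smul_eq_mul] at hr
    have hy : y = 0 := by linarith [hr.2]
    subst hy
    exact ⟨rfl, by linarith⟩
  · rintro ⟨rfl, h⟩
    refine ⟨by linarith, x / a, ?_⟩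
    simp only [AffineMap.lineMap_apply, vsub_eq_sub, vadd_eq_add, Prod.ext_iff, Prod.smul_mk,
      Prod.mk_sub_mk, Prod.mk_add_mk, smul_eq_mul]
    constructor
    · field_simp
      ring
    · ring

/-- The distance of a point of the Klein disk from the horizontal diameter. -/
lemma distTo_axis {a : ℝ} (ha : a ≠ 0) {p : ℝ × ℝ} (hp : p ∈ kleinDisk) :
    distTo (kleinLine A1 (P1 a)) p =
      Real.arcosh (√((1 - p.1 ^ 2) / (1 - p.1 ^ 2 - p.2 ^ 2))) := by
  obtain ⟨x, y⟩ := p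
  simp only [kleinDisk, mem_ofPred_eq] at hp
  have hd : 0 < 1 - x ^ 2 - y ^ 2 := by linarith
  have hx : 0 < 1 - x ^ 2 := by nlinarith [sq_nonneg y]
  -- The base line is a diameter, so the hyperbolic foot of the perpendicular is the Euclidean one.
  have hmem : ((x, 0) : ℝ × ℝ) ∈ kleinLine A1 (P1 a) :=
    (mem_kleinLine_axis ha _).2 ⟨rfl, by simp only; linarith⟩
  have hfoot : kleinDist (x, y) (x, 0) = Real.arcosh (√((1 - x ^ 2) / (1 - x ^ 2 - y ^ 2))) := by
    simp only [kleinDist]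
    congr 1
    rw [eq_comm, Real.sqrt_eq_iff_mul_self_eq (div_pos hx hd).le
      (div_nonneg (by nlinarith) (Real.sqrt_nonneg _))]
    rw [← sq, div_pow, Real.sq_sqrt (by apply mul_nonneg hd.le; nlinarith)]
    rw [div_eq_div_iff hd.ne' (ne_of_gt (mul_pos hd (by linarith)))]
    ring
  have hle : ∀ q : kleinLine A1 (P1 a),
      Real.arcosh (√((1 - x ^ 2) / (1 - x ^ 2 - y ^ 2))) ≤ kleinDist (x, y) q := by
    rintro ⟨⟨t, s⟩, hq⟩
    obtain ⟨hs, ht⟩ := (mem_kleinLine_axis ha _).1 hq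
    simp only at hs ht
    subst hs
    have ht' : 0 < 1 - t ^ 2 := by linarith
    have hxt : 0 < 1 - x * t := by nlinarith [sq_nonneg (x - t)]
    have hD : 0 < (1 - x ^ 2 - y ^ 2) * (1 - t ^ 2) := mul_pos hd ht'
    simp only [kleinDist, mul_zero, sub_zero, ne_eq, OfNat.ofNat_ne_zero, not_false_eq_true,
      zero_pow]
    rw [Real.arcosh_le_arcosh (Real.sqrt_pos.2 (div_pos hx hd))
      (div_pos hxt (Real.sqrt_pos.2 hD))]
    apply Real.sqrt_le_iff.2
    refine ⟨(div_pos hxt (Real.sqrt_pos.2 hD)).le, ?_⟩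
    rw [div_pow, Real.sq_sqrt hD.le, div_le_div_iff₀ hd hD]
    -- The difference of the two sides is (x − t)², so t = x minimises the distance.
    have : (1 - x ^ 2) * (1 - t ^ 2) ≤ (1 - x * t) ^ 2 := by nlinarith [sq_nonneg (x - t)]
    nlinarith [mul_le_mul_of_nonneg_right this hd.le]
  have : Nonempty (kleinLine A1 (P1 a)) := ⟨⟨_, hmem⟩⟩
  refine le_antisymm ?_ (le_ciInf hle)
  exact (ciInf_le ⟨_, by rintro _ ⟨q, rfl⟩; exact hle q⟩ ⟨_, hmem⟩).trans_eq hfoot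

lemma T_mem_kleinDisk {s : ℝ} (h0 : 0 ≤ s) (h1 : s < 1) : T s ∈ kleinDisk := by
  simp only [T, kleinDisk, mem_ofPred_eq]
  nlinarith

lemma sq_ratio_le_iff {x y s : ℝ} (hp : x ^ 2 + y ^ 2 < 1) (hs : s ^ 2 < 1) :
    (1 - x ^ 2) / (1 - x ^ 2 - y ^ 2) ≤ 1 / (1 - s ^ 2) ↔ y ^ 2 ≤ s ^ 2 * (1 - x ^ 2) := by
  rw [div_le_div_iff₀ (by linarith) (by linarith)]
  constructor <;> intro h <;> nlinarith

lemma ratio_pos {x y : ℝ} (hp : x ^ 2 + y ^ 2 < 1) : 0 < (1 - x ^ 2) / (1 - x ^ 2 - y ^ 2) :=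
  div_pos (by nlinarith [sq_nonneg y]) (by linarith)

/-- Since `arcosh` and the square root are increasing, comparing distances amounts to comparing the
ratios (1 − x²)/(1 − x² − y²). -/
lemma mem_hyperball_iff {a s : ℝ} (ha : a ≠ 0) (h0 : 0 ≤ s) (h1 : s < 1) (p : ℝ × ℝ) :
    p ∈ hyperball a s ↔ p ∈ kleinDisk ∧ p.2 ^ 2 ≤ s ^ 2 * (1 - p.1 ^ 2) := by
  have hs : s ^ 2 < 1 := by nlinarith
  refine and_congr_right fun hp => ?_
  have hp' := hp
  simp only [kleinDisk, mem_ofPred_eq] at hp'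
  rw [distTo_axis ha hp, distTo_axis ha (T_mem_kleinDisk h0 h1),
    Real.arcosh_le_arcosh (Real.sqrt_pos.2 (ratio_pos hp'))
      (Real.sqrt_pos.2 (ratio_pos (T_mem_kleinDisk h0 h1))),
    Real.sqrt_le_sqrt_iff (ratio_pos (T_mem_kleinDisk h0 h1)).le]
  simpa [T] using sq_ratio_le_iff hp' hs

lemma mem_hypercycle_iff {a s : ℝ} (ha : a ≠ 0) (h0 : 0 ≤ s) (h1 : s < 1) (p : ℝ × ℝ) :
    p ∈ hypercycle a s ↔ p ∈ kleinDisk ∧ p.2 ^ 2 = s ^ 2 * (1 - p.1 ^ 2) := by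
  have hs : s ^ 2 < 1 := by nlinarith
  refine and_congr_right fun hp => ?_
  have hp' := hp
  simp only [kleinDisk, mem_ofPred_eq] at hp'
  have hT := ratio_pos (T_mem_kleinDisk h0 h1)
  rw [distTo_axis ha hp, distTo_axis ha (T_mem_kleinDisk h0 h1),
    Real.strictMonoOn_arcosh.injOn.eq_iff (Real.sqrt_pos.2 (ratio_pos hp')) (Real.sqrt_pos.2 hT),
    Real.sqrt_inj (ratio_pos hp').le hT.le]
  simp only [T, ne_eq, OfNat.ofNat_ne_zero, not_false_eq_true, zero_pow, sub_zero]
  rw [div_eq_div_iff (by linarith) (by linarith)]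
  constructor <;> intro h <;> linarith

lemma mem_horoball_iff (s : ℝ) (p : ℝ × ℝ) :
    p ∈ horoball s ↔ p ∈ kleinDisk ∧
      (1 + s) * (1 - p.2) ^ 2 ≤ (1 - s) * (1 - p.1 ^ 2 - p.2 ^ 2) := by
  refine and_congr_right fun _ => ?_
  constructor <;> intro h <;> linarith

/-- Dropping the x² term and cancelling 1 − y leaves a linear inequality. Together with
`le_of_mem_hyperball` this makes a horizontal line separate the two bodies. -/
lemma le_of_mem_horoball {s : ℝ} (h1 : s < 1) {p : ℝ × ℝ} (hp : p ∈ horoball s) : s ≤ p.2 := by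
  obtain ⟨hd, h⟩ := (mem_horoball_iff s p).1 hp
  simp only [kleinDisk, mem_ofPred_eq] at hd
  have hy : p.2 < 1 := by nlinarith [sq_nonneg p.1]
  have h2 : 0 ≤ (1 - p.2) * (p.2 - s) := by nlinarith [mul_nonneg (sub_nonneg.2 h1.le) (sq_nonneg p.1)]
  nlinarith [nonneg_of_mul_nonneg_right h2 (by linarith)]

lemma le_of_mem_hyperball {a s : ℝ} (ha : a ≠ 0) (h0 : 0 ≤ s) (h1 : s < 1) {p : ℝ × ℝ}
    (hp : p ∈ hyperball a s) : p.2 ≤ s := by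
  obtain ⟨_, h⟩ := (mem_hyperball_iff ha h0 h1 p).1 hp
  apply le_of_sq_le_sq _ h0
  nlinarith [mul_nonneg (sq_nonneg s) (sq_nonneg p.1)]

/-! ### The packing conditions as inequalities -/

lemma isOpen_kleinDisk : IsOpen kleinDisk :=
  isOpen_lt (by fun_prop) continuous_const

lemma horoball_inter_hyperball_subset {a y₁ y₂ : ℝ} (ha : a ≠ 0) (h1 : y₁ < 1) (h0 : 0 ≤ y₂)
    (h2 : y₂ < 1) (h : y₂ ≤ y₁) : horoball y₁ ∩ hyperball a y₂ ⊆ univ ×ˢ {y₁} := by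
  rintro p ⟨hp, hq⟩
  have := le_of_mem_horoball h1 hp
  have := le_of_mem_hyperball ha h0 h2 hq
  simp only [mem_prod, mem_univ, mem_singleton_iff, true_and]
  linarith

/-- If y₁ < y₂, the midpoint on the side A₁A₀ is interior to both; otherwise the intersection lies
in a line, which has empty interior. -/
lemma disjoint_interior_iff {a y₁ y₂ : ℝ} (ha : a ≠ 0) (h0 : 0 ≤ y₁) (h1 : y₁ < 1) (h0' : 0 ≤ y₂)
    (h2 : y₂ < 1) :
    Disjoint (interior (horoball y₁)) (interior (hyperball a y₂)) ↔ y₂ ≤ y₁ := by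
  constructor
  · intro h
    by_contra! hlt
    set m := (y₁ + y₂) / 2 with hm
    have hm1 : y₁ < m := by linarith
    have hm2 : m < y₂ := by linarith
    have hm3 : m < 1 := by linarith
    refine Set.disjoint_left.1 h (?_ : ((0, m) : ℝ × ℝ) ∈ _) ?_
    · apply interior_maximal (s := horoball y₁) (t := kleinDisk ∩
        {p | (1 + y₁) * (1 - p.2) ^ 2 < (1 - y₁) * (1 - p.1 ^ 2 - p.2 ^ 2)})
      · intro p hp
        exact (mem_horoball_iff _ _).2 ⟨hp.1, le_of_lt hp.2⟩
      · exact isOpen_kleinDisk.inter (isOpen_lt (by fun_prop) (by fun_prop))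
      · refine ⟨T_mem_kleinDisk (by linarith) hm3, ?_⟩
        simp only [mem_ofPred_eq]
        nlinarith [mul_pos (sub_pos.2 hm1) (sub_pos.2 hm3)]
    · apply interior_maximal (s := hyperball a y₂) (t := kleinDisk ∩
        {p | p.2 ^ 2 < y₂ ^ 2 * (1 - p.1 ^ 2)})
      · intro p hp
        exact (mem_hyperball_iff ha h0' h2 _).2 ⟨hp.1, le_of_lt hp.2⟩
      · exact isOpen_kleinDisk.inter (isOpen_lt (by fun_prop) (by fun_prop))
      · refine ⟨T_mem_kleinDisk (by linarith) hm3, ?_⟩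
        simp only [mem_ofPred_eq]
        nlinarith
  · intro h
    rw [Set.disjoint_iff_inter_eq_empty, ← interior_inter]
    refine subset_empty_iff.1 ((interior_mono
      (horoball_inter_hyperball_subset ha h1 h0' h2 h)).trans ?_)
    rw [interior_prod_eq, interior_singleton, prod_empty]

lemma A0_P0_segment {a x : ℝ} (ha : 0 < a) (h0 : 0 < x) (h1 : x < a) :
    ((x, 1 - a * x) : ℝ × ℝ) ∈ openSegment ℝ A0 (P0 a) := by
  refine ⟨1 - x / a, x / a, by rw [sub_pos, div_lt_one ha]; exact h1, by positivity, by ring, ?_⟩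
  simp only [A0, P0, Prod.smul_mk, Prod.mk_add_mk, smul_eq_mul, Prod.mk.injEq]
  constructor
  · field_simp
    ring
  · field_simp
    ring

/-- For s² = 1 − a² the hypercycle is tangent to the side A₀P₀ at P₀, which the open segment omits.
For larger s, P₀ is strictly inside, and by continuity so are nearby points of the segment. -/
lemma disjoint_hyperball_iff {a s : ℝ} (ha : 0 < a) (ha1 : a < 1) (h0 : 0 ≤ s) (h1 : s < 1) :
    Disjoint (hyperball a s) (openSegment ℝ A0 (P0 a)) ↔ s ^ 2 ≤ 1 - a ^ 2 := by
  have hc : 0 < 1 - a ^ 2 := by nlinarith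
  constructor
  · intro h
    by_contra! hlt
    have hcont : ContinuousAt (fun x : ℝ => s ^ 2 * (1 - x ^ 2) - (1 - a * x) ^ 2) a := by fun_prop
    have hpos : 0 < s ^ 2 * (1 - a ^ 2) - (1 - a * a) ^ 2 := by nlinarith
    have hev := (hcont.eventually (lt_mem_nhds hpos)).filter_mono
      (nhdsWithin_le_nhds (s := Iio a))
    obtain ⟨x, hx, hxa, hx0⟩ := (hev.and ((eventually_mem_nhdsWithin (s := Iio a)).and
      (nhdsWithin_le_nhds (lt_mem_nhds ha)))).exists
    simp only [mem_Iio] at hxa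
    refine Set.disjoint_left.1 h ?_ (A0_P0_segment ha hx0 hxa)
    refine (mem_hyperball_iff ha.ne' h0 h1 _).2 ⟨?_, ?_⟩
    · simp only [kleinDisk, mem_ofPred_eq]
      nlinarith [mul_pos hx0 (sub_pos.2 hxa), mul_pos hx0 hc]
    · simp only
      linarith
  · intro h
    rw [Set.disjoint_right]
    rintro _ ⟨u, v, hu, hv, huv, rfl⟩ hmem
    obtain ⟨_, h2⟩ := (mem_hyperball_iff ha.ne' h0 h1 _).1 hmem
    obtain rfl : u = 1 - v := by linarith
    simp only [A0, P0, Prod.smul_mk, Prod.mk_add_mk, smul_eq_mul] at h2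
    have hva : 0 < 1 - (v * a) ^ 2 := by
      have : v * a < 1 := by nlinarith
      nlinarith [mul_pos hv ha]
    have key : (1 - v + v * (1 - a ^ 2)) ^ 2 - (1 - a ^ 2) * (1 - (v * a) ^ 2)
        = a ^ 2 * (1 - v) ^ 2 := by ring
    have h3 := mul_le_mul_of_nonneg_right h hva.le
    have h4 : 0 < a ^ 2 * (1 - v) ^ 2 := by positivity
    have h5 : s ^ 2 * (1 - ((1 - v) * 0 + v * a) ^ 2) = s ^ 2 * (1 - (v * a) ^ 2) := by ring
    have h6 : (1 - v) * 1 + v * (1 - a ^ 2) = 1 - v + v * (1 - a ^ 2) := by ring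
    rw [h5, h6] at h2
    linarith

/-- Even for s = 0 the horocycle meets the base line only at A₁, an omitted endpoint. -/
lemma disjoint_horoball_base {a s : ℝ} (ha : 0 < a) (h0 : 0 ≤ s) (h1 : s < 1) :
    Disjoint (horoball s) (openSegment ℝ A1 (P1 a)) := by
  rw [Set.disjoint_right]
  rintro _ ⟨u, v, hu, hv, huv, rfl⟩ hmem
  obtain ⟨_, h2⟩ := (mem_horoball_iff _ _).1 hmem
  simp only [A1, P1, Prod.smul_mk, Prod.mk_add_mk, smul_eq_mul, mul_zero, zero_add] at h2
  have : 0 < (1 - s) * (v * a) ^ 2 := by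
    have := sub_pos.2 h1
    positivity
  nlinarith

lemma disjoint_horoball_iff {a s : ℝ} (ha : 0 < a) (ha1 : a < 1) :
    Disjoint (horoball s) (openSegment ℝ (P0 a) (P1 a)) ↔ 1 - 2 * a ^ 2 ≤ s := by
  have hc : 0 < 1 - a ^ 2 := by nlinarith
  constructor
  · intro h
    by_contra! hlt
    have hcont : ContinuousAt (fun y : ℝ => (1 - s) * (1 - a ^ 2 - y ^ 2) - (1 + s) * (1 - y) ^ 2)
      (1 - a ^ 2) := by fun_prop
    have hpos : 0 < (1 - s) * (1 - a ^ 2 - (1 - a ^ 2) ^ 2) -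
        (1 + s) * (1 - (1 - a ^ 2)) ^ 2 := by
      nlinarith [mul_pos (sub_pos.2 hlt) (pow_pos ha 2)]
    have hev := (hcont.eventually (lt_mem_nhds hpos)).filter_mono
      (nhdsWithin_le_nhds (s := Iio (1 - a ^ 2)))
    obtain ⟨y, hy, hya, hy0⟩ := (hev.and ((eventually_mem_nhdsWithin (s := Iio (1 - a ^ 2))).and
      (nhdsWithin_le_nhds (lt_mem_nhds hc)))).exists
    simp only [mem_Iio] at hya
    refine Set.disjoint_left.1 h (?_ : ((a, y) : ℝ × ℝ) ∈ _) ?_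
    · refine (mem_horoball_iff _ _).2 ⟨?_, ?_⟩
      · simp only [kleinDisk, mem_ofPred_eq]
        nlinarith [pow_pos ha 2]
      · simp only
        linarith
    · refine ⟨y / (1 - a ^ 2), 1 - y / (1 - a ^ 2), by positivity, ?_, by ring, ?_⟩
      · rw [sub_pos, div_lt_one hc]
        exact hya
      · simp only [P0, P1, Prod.smul_mk, Prod.mk_add_mk, smul_eq_mul, Prod.mk.injEq]
        constructor
        · ring
        · field_simp
          ring
  · intro h
    rw [Set.disjoint_right]
    rintro _ ⟨u, v, hu, hv, huv, rfl⟩ hmem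
    obtain ⟨_, h2⟩ := (mem_horoball_iff _ _).1 hmem
    obtain rfl : v = 1 - u := by linarith
    simp only [P0, P1, Prod.smul_mk, Prod.mk_add_mk, smul_eq_mul, mul_zero, add_zero] at h2
    have e : u * a + (1 - u) * a = a := by ring
    rw [e] at h2
    -- The horocycle equation on P₀P₁, expanded about P₀ (u = 1): the last term is its value at P₀,
    -- and the other is positive for u < 1.
    have key : (1 + s) * (1 - u * (1 - a ^ 2)) ^ 2 - (1 - s) * (1 - a ^ 2 - (u * (1 - a ^ 2)) ^ 2)
      = 2 * ((1 - a ^ 2) * (1 - u)) * (1 + s - (1 - a ^ 2) * (1 + u))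
        + a ^ 2 * (s - (1 - 2 * a ^ 2)) := by ring
    have h3 : 0 < (1 - a ^ 2) * (1 - u) := mul_pos hc hv
    have h4 : 0 < 1 + s - (1 - a ^ 2) * (1 + u) := by nlinarith
    have h5 : 0 ≤ a ^ 2 * (s - (1 - 2 * a ^ 2)) := by
      have := sub_nonneg.2 h
      positivity
    nlinarith [mul_pos h3 h4]

/-- The packing conditions as inequalities between the parameters. -/
lemma isPacking_iff {a y₁ y₂ : ℝ} : IsPacking a y₁ y₂ ↔
    0 < a ∧ a < 1 ∧ 0 ≤ y₁ ∧ y₁ < 1 ∧ 0 ≤ y₂ ∧ 1 - 2 * a ^ 2 ≤ y₁ ∧ y₂ ^ 2 ≤ 1 - a ^ 2 ∧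
      y₂ ≤ y₁ := by
  constructor
  · rintro ⟨h1, h2, h3, h4, h5, h6, -, h8, h9, h10⟩
    exact ⟨h1, h2, h3, h4, h5, (disjoint_horoball_iff h1 h2).1 h8,
      (disjoint_hyperball_iff h1 h2 h5 h6).1 h9, (disjoint_interior_iff h1.ne' h3 h4 h5 h6).1 h10⟩
  · rintro ⟨h1, h2, h3, h4, h5, h8, h9, h10⟩
    have h6 : y₂ < 1 := h10.trans_lt h4
    exact ⟨h1, h2, h3, h4, h5, h6, disjoint_horoball_base h1 h3 h4,
      (disjoint_horoball_iff h1 h2).2 h8,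
      (disjoint_hyperball_iff h1 h2 h5 h6).2 h9, (disjoint_interior_iff h1.ne' h3 h4 h5 h6).2 h10⟩

/-! ### Parameters of the two main types -/

lemma P0_mem_kleinDisk {a : ℝ} (h0 : 0 < a) (h1 : a < 1) : P0 a ∈ kleinDisk := by
  simp only [P0, kleinDisk, mem_ofPred_eq]
  have : 0 < 1 - a ^ 2 := by nlinarith
  nlinarith [mul_pos (pow_pos h0 2) this]

lemma isType1_iff (a y : ℝ) : IsType1 a y ↔ 0 < a ∧ a < 1 ∧ y = √(1 - a ^ 2) := by
  constructor
  · rintro ⟨hp, hm⟩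
    obtain ⟨h1, h2, h3, h4, h5, h8, h9, h10⟩ := isPacking_iff.1 hp
    refine ⟨h1, h2, ?_⟩
    have hc : 0 < 1 - a ^ 2 := by nlinarith
    have := ((mem_hypercycle_iff h1.ne' h3 h4 _).1 hm).2
    simp only [P0] at this
    rw [eq_comm, Real.sqrt_eq_iff_mul_self_eq hc.le h3]
    have h' : (1 - a ^ 2) * (1 - a ^ 2 - y ^ 2) = 0 := by linarith
    rcases mul_eq_zero.1 h' with h | h <;> linarith
  · rintro ⟨h1, h2, rfl⟩
    have hc : 0 < 1 - a ^ 2 := by nlinarith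
    have hs := Real.sq_sqrt hc.le
    have h0 := Real.sqrt_nonneg (1 - a ^ 2)
    have hlt : √(1 - a ^ 2) < 1 := by
      rw [Real.sqrt_lt' one_pos]
      nlinarith
    refine ⟨isPacking_iff.2 ⟨h1, h2, h0, hlt, h0, ?_, hs.le, le_rfl⟩, ?_⟩
    · nlinarith
    · rw [mem_hypercycle_iff h1.ne' h0 hlt]
      refine ⟨P0_mem_kleinDisk h1 h2, ?_⟩
      rw [hs]
      simp only [P0]
      ring

lemma le_one_div_sqrt_two_iff {a : ℝ} (ha : 0 < a) : a ≤ 1 / √2 ↔ 0 ≤ 1 - 2 * a ^ 2 := by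
  rw [one_div, ← Real.sqrt_inv, Real.le_sqrt' ha]
  constructor <;> intro h <;> linarith

lemma isType2_iff (a y : ℝ) : IsType2 a y ↔ 0 < a ∧ a ≤ 1 / √2 ∧ y = 1 - 2 * a ^ 2 := by
  constructor
  · rintro ⟨hp, hm⟩
    obtain ⟨h1, h2, h3, h4, h5, h8, h9, h10⟩ := isPacking_iff.1 hp
    have := hm.2
    simp only [P0] at this
    have h' : 2 * a ^ 2 * (y - (1 - 2 * a ^ 2)) = 0 := by
      have e : (y - 1) * (-1 + a ^ 2 + (1 - a ^ 2) ^ 2) - (1 + y) * (1 - (1 - a ^ 2)) ^ 2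
        = - (a ^ 2 * (y - (1 - 2 * a ^ 2))) := by ring
      linarith
    rcases mul_eq_zero.1 h' with h | h
    · have := pow_pos h1 2
      linarith
    · have hy : y = 1 - 2 * a ^ 2 := by linarith
      exact ⟨h1, (le_one_div_sqrt_two_iff h1).2 (by linarith), hy⟩
  · rintro ⟨h1, h2, rfl⟩
    rw [le_one_div_sqrt_two_iff h1] at h2
    have ha := pow_pos h1 2
    have h3 : a < 1 := by nlinarith
    refine ⟨isPacking_iff.2 ⟨h1, h3, h2, by linarith, h2, le_rfl, by nlinarith, le_rfl⟩,
      P0_mem_kleinDisk h1 h3, ?_⟩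
    simp only [P0]
    ring

/-! ### Areas of the domain and the hyperball by vertical slicing -/

/-- The inequalities are convex and hold at the vertices; conversely, each point lies on a vertical
segment joining the sides A₁P₁ and A₀P₀. -/
lemma fundDomain_eq {a : ℝ} (ha : 0 < a) (ha1 : a < 1) : fundDomain a =
    kleinDisk ∩ {p | (0 ≤ p.1 ∧ p.1 ≤ a) ∧ 0 ≤ p.2 ∧ p.2 ≤ 1 - a * p.1} := by
  refine congrArg (kleinDisk ∩ ·) (Subset.antisymm ?_ ?_)
  · have ha2 : a * a ≤ 1 := by nlinarith
    apply convexHull_min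
    · rintro p (rfl | rfl | rfl | rfl) <;> simp [A0, A1, P1, P0, ha.le, ← sq] <;>
        exact abs_le.2 ⟨by linarith, ha1.le⟩
    · rintro ⟨x, y⟩ hp ⟨z, w⟩ hq u v hu hv huv
      obtain rfl : u = 1 - v := by linarith
      simp only [mem_ofPred_eq, Prod.smul_mk, Prod.mk_add_mk, smul_eq_mul] at hp hq ⊢
      obtain ⟨⟨p1, p2⟩, p3, p4⟩ := hp
      obtain ⟨⟨q1, q2⟩, q3, q4⟩ := hq
      have r4 := mul_le_mul_of_nonneg_left p4 hu
      have s4 := mul_le_mul_of_nonneg_left q4 hv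
      refine ⟨⟨by positivity, ?_⟩, by positivity, by linarith⟩
      nlinarith [mul_le_mul_of_nonneg_left p2 hu, mul_le_mul_of_nonneg_left q2 hv]
  · rintro ⟨x, y⟩ ⟨⟨h1, h2⟩, h3, h4⟩
    simp only at h1 h2 h3 h4
    have hconv := convex_convexHull ℝ ({A0, A1, P1 a, P0 a} : Set (ℝ × ℝ))
    have hsub := subset_convexHull ℝ ({A0, A1, P1 a, P0 a} : Set (ℝ × ℝ))
    have hv0 : 0 ≤ x / a := by positivity
    have hv1 : 0 ≤ 1 - x / a := by
      rw [sub_nonneg, div_le_one ha]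
      exact h2
    have hbot : ((x, 0) : ℝ × ℝ) ∈ convexHull ℝ ({A0, A1, P1 a, P0 a} : Set (ℝ × ℝ)) := by
      convert hconv (hsub (show A1 ∈ _ by simp)) (hsub (show P1 a ∈ _ by simp)) hv1 hv0 (by ring)
        using 1
      simp only [A1, P1, Prod.smul_mk, Prod.mk_add_mk, smul_eq_mul, Prod.mk.injEq]
      constructor
      · field_simp
        ring
      · ring
    have htop : ((x, 1 - a * x) : ℝ × ℝ) ∈ convexHull ℝ ({A0, A1, P1 a, P0 a} : Set (ℝ × ℝ)) := by
      convert hconv (hsub (show A0 ∈ _ by simp)) (hsub (show P0 a ∈ _ by simp)) hv1 hv0 (by ring)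
        using 1
      simp only [A0, P0, Prod.smul_mk, Prod.mk_add_mk, smul_eq_mul, Prod.mk.injEq]
      constructor
      · field_simp
        ring
      · field_simp
        ring
    have hpos : 0 < 1 - a * x := by nlinarith
    have hw1 : 0 ≤ 1 - y / (1 - a * x) := by
      rw [sub_nonneg, div_le_one hpos]
      exact h4
    convert hconv hbot htop hw1 (by positivity : 0 ≤ y / (1 - a * x)) (by ring) using 1
    simp only [Prod.smul_mk, Prod.mk_add_mk, smul_eq_mul, Prod.mk.injEq]
    constructor
    · ring
    · field_simp
      ring

/-- The fundamental theorem of calculus for a nonnegative derivative, as a Lebesgue integral. -/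
lemma lintegral_Ioo_deriv {g g' : ℝ → ℝ} {l r : ℝ} (h : l ≤ r) (hcont : ContinuousOn g (Icc l r))
    (hderiv : ∀ x ∈ Ioo l r, HasDerivAt g (g' x) x) (hpos : ∀ x ∈ Ioo l r, 0 ≤ g' x) :
    ∫⁻ x in Ioo l r, ENNReal.ofReal (g' x) = ENNReal.ofReal (g r - g l) := by
  have hint := intervalIntegral.integrableOn_deriv_of_nonneg hcont hderiv hpos
  rw [← ofReal_integral_eq_lintegral_ofReal (hint.mono_set Ioo_subset_Ioc_self)
    ((ae_restrict_mem measurableSet_Ioo).mono hpos), ← integral_Ioc_eq_integral_Ioo,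
    ← intervalIntegral.integral_of_le h, intervalIntegral.integral_eq_sub_of_hasDerivAt_of_le h
      hcont hderiv ((intervalIntegrable_iff_integrableOn_Ioc_of_le h).2 hint)]

lemma rpow_three_halves {q : ℝ} (hq : 0 < q) : q ^ (3 / 2 : ℝ) = q * √q := by
  rw [show (3 / 2 : ℝ) = 1 + 1 / 2 by norm_num, Real.rpow_add hq, Real.rpow_one,
    ← Real.sqrt_eq_rpow]

lemma measurable_areaDensity : Measurable
    (fun p : ℝ × ℝ => ENNReal.ofReal (1 / (1 - p.1 ^ 2 - p.2 ^ 2) ^ (3 / 2 : ℝ))) := by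
  fun_prop

lemma area_apply {S : Set (ℝ × ℝ)} (hS : MeasurableSet S) (hsub : S ⊆ kleinDisk) :
    area S = ∫⁻ p in S, ENNReal.ofReal (1 / (1 - p.1 ^ 2 - p.2 ^ 2) ^ (3 / 2 : ℝ)) := by
  rw [area, withDensity_apply _ hS, Measure.restrict_restrict hS, inter_eq_self_of_subset_left hsub]

lemma hasDerivAt_vertical {m y : ℝ} (hm : 0 < m) (hy : y ^ 2 < m) :
    HasDerivAt (fun y => y / (m * √(m - y ^ 2))) (1 / (m - y ^ 2) ^ (3 / 2 : ℝ)) y := by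
  have hq : 0 < m - y ^ 2 := by linarith
  have hs : 0 < √(m - y ^ 2) := Real.sqrt_pos.2 hq
  have hss := Real.sq_sqrt hq.le
  have h1 : HasDerivAt (fun y : ℝ => m - y ^ 2) (-(2 * y)) y := by
    simpa using (hasDerivAt_pow 2 y).const_sub m
  have h2 := (h1.sqrt hq.ne').const_mul m
  have h3 := (hasDerivAt_id y).div h2 (by positivity)
  convert! h3 using 1
  rw [rpow_three_halves hq]
  simp only [id]
  field_simp
  rw [hss]
  ring

lemma lintegral_vertical {x h : ℝ} (h0 : 0 ≤ h) (hx : x ^ 2 + h ^ 2 < 1) :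
    ∫⁻ y in Ioo 0 h, ENNReal.ofReal (1 / (1 - x ^ 2 - y ^ 2) ^ (3 / 2 : ℝ)) =
      ENNReal.ofReal (h / ((1 - x ^ 2) * √(1 - x ^ 2 - h ^ 2))) := by
  have hm : 0 < 1 - x ^ 2 := by nlinarith [sq_nonneg h]
  have hlt : ∀ y ∈ Icc 0 h, y ^ 2 < 1 - x ^ 2 := fun y hy => by nlinarith [hy.1, hy.2]
  have hder : ∀ y ∈ Icc 0 h, HasDerivAt (fun y => y / ((1 - x ^ 2) * √(1 - x ^ 2 - y ^ 2)))
      (1 / (1 - x ^ 2 - y ^ 2) ^ (3 / 2 : ℝ)) y := fun y hy => hasDerivAt_vertical hm (hlt y hy)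
  rw [lintegral_Ioo_deriv h0 (fun y hy => (hder y hy).continuousAt.continuousWithinAt)
    (fun y hy => hder y (Ioo_subset_Icc_self hy)) (fun y hy => ?_)]
  · simp
  · have := hlt y (Ioo_subset_Icc_self hy)
    exact div_nonneg zero_le_one (Real.rpow_nonneg (by linarith) _)

/-- The area of the region between the base line and the graph of `φ`, from an antiderivative of
the vertical integrals. -/
lemma area_subgraph {a : ℝ} (ha : 0 < a) {φ G : ℝ → ℝ} {S : Set (ℝ × ℝ)}
    (hS : S = kleinDisk ∩ {p | (0 ≤ p.1 ∧ p.1 ≤ a) ∧ 0 ≤ p.2 ∧ p.2 ≤ φ p.1})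
    (hφm : Measurable φ) (hφ0 : ∀ x ∈ Ioo 0 a, 0 ≤ φ x)
    (hφ1 : ∀ x ∈ Ioo 0 a, x ^ 2 + φ x ^ 2 < 1) (hG : ContinuousOn G (Icc 0 a))
    (hderiv : ∀ x ∈ Ioo 0 a,
      HasDerivAt G (φ x / ((1 - x ^ 2) * √(1 - x ^ 2 - φ x ^ 2))) x) :
    area S = ENNReal.ofReal (G a - G 0) := by
  have hSm : MeasurableSet S := by
    rw [hS]
    refine isOpen_kleinDisk.measurableSet.inter (((measurableSet_le measurable_const
      measurable_fst).inter (measurableSet_le measurable_fst measurable_const)).inter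
      ((measurableSet_le measurable_const measurable_snd).inter
      (measurableSet_le measurable_snd (hφm.comp measurable_fst))))
  rw [area_apply hSm (hS ▸ inter_subset_left), ← lintegral_indicator hSm,
    Measure.volume_eq_prod, lintegral_prod _ (measurable_areaDensity.indicator hSm).aemeasurable,
    ← lintegral_Ioo_deriv ha.le hG hderiv, ← lintegral_indicator measurableSet_Ioo]
  · apply lintegral_congr_ae
    filter_upwards [Measure.ae_ne volume (0 : ℝ), Measure.ae_ne volume a] with x hx0 hxa
    by_cases hx : x ∈ Ioo 0 a
    · rw [indicator_of_mem hx, ← lintegral_vertical (hφ0 x hx) (hφ1 x hx),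
        restrict_Ioo_eq_restrict_Icc, ← lintegral_indicator measurableSet_Icc]
      refine lintegral_congr fun y => ?_
      have hmem : (x, y) ∈ S ↔ y ∈ Icc 0 (φ x) := by
        rw [hS]
        simp only [kleinDisk, mem_inter_iff, mem_ofPred_eq, mem_Icc, hx.1.le, hx.2.le, true_and,
          and_iff_right_iff_imp]
        rintro ⟨h1, h2⟩
        nlinarith [hφ1 x hx]
      by_cases hy : y ∈ Icc 0 (φ x)
      · rw [indicator_of_mem hy, indicator_of_mem (hmem.2 hy)]
      · rw [indicator_of_notMem hy, indicator_of_notMem (mt hmem.1 hy)]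
    · rw [indicator_of_notMem hx]
      refine (lintegral_congr fun y => indicator_of_notMem ?_ _).trans lintegral_zero
      intro hxy
      rw [hS] at hxy
      obtain ⟨⟨h1, h2⟩, -⟩ := hxy.2
      exact hx ⟨lt_of_le_of_ne h1 (Ne.symm hx0), lt_of_le_of_ne h2 hxa⟩
  · intro x hx
    have := hφ1 x hx
    exact div_nonneg (hφ0 x hx) (mul_nonneg (by nlinarith [sq_nonneg (φ x)]) (Real.sqrt_nonneg _))

lemma hasDerivAt_artanh {x : ℝ} (h0 : -1 < x) (h1 : x < 1) :
    HasDerivAt Real.artanh (1 / (1 - x ^ 2)) x := by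
  have hp : 0 < 1 + x := by linarith
  have hm : 0 < 1 - x := by linarith
  have h : HasDerivAt (fun x : ℝ => 1 / 2 * Real.log ((1 + x) / (1 - x))) (1 / (1 - x ^ 2)) x := by
    have h2 := ((((hasDerivAt_id x).const_add 1).div ((hasDerivAt_id x).const_sub 1)
      hm.ne').log (div_pos hp hm).ne').const_mul (1 / 2)
    convert! h2 using 1
    have : 1 - x ^ 2 = (1 + x) * (1 - x) := by ring
    rw [this]
    simp only [id, Pi.div_apply]
    field_simp
    ring
  refine h.congr_of_eventuallyEq ?_
  filter_upwards [Ioo_mem_nhds h0 h1] with z hz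
  exact Real.artanh_eq_half_log ⟨hz.1.le, hz.2.le⟩

/-- The Lambert quadrilateral has angles `0, π/2, π/2, π/2` and area `π/2`. -/
lemma area_fundDomain {a : ℝ} (ha : 0 < a) (ha1 : a < 1) :
    area (fundDomain a) = ENNReal.ofReal (Real.pi / 2) := by
  have hx1 : ∀ x ∈ Icc 0 a, 0 < 1 - x ^ 2 := fun x hx => by nlinarith [hx.1, hx.2]
  have hφ : ∀ x ∈ Ioo 0 a, 0 < 1 - a * x := fun x hx => by nlinarith [hx.1, hx.2]
  have hQ : ∀ x ∈ Ioo 0 a, 0 < 1 - x ^ 2 - (1 - a * x) ^ 2 := fun x hx => by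
    have h1 : 1 - x ^ 2 - (1 - a * x) ^ 2 = x * ((a - x) + a * (1 - a * x)) := by ring
    rw [h1]
    exact mul_pos hx.1 (add_pos (sub_pos.2 hx.2) (mul_pos ha (hφ x hx)))
  -- The slice integral blows up at x = 0, below the ideal vertex, but `G` stays continuous there.
  -- Its endpoint values −arcsin 1 and 0 give π/2, independently of a.
  rw [area_subgraph ha (fundDomain_eq ha ha1) (φ := fun x => 1 - a * x)
    (G := fun x => - Real.arcsin ((a - x) / (a * √(1 - x ^ 2)))) (by fun_prop)
    (fun x hx => (hφ x hx).le) (fun x hx => by linarith [hQ x hx]) ?_ ?_]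
  · simp [ha.ne']
  · refine (Real.continuous_arcsin.comp_continuousOn (ContinuousOn.div (by fun_prop)
      (by fun_prop) ?_)).neg
    intro x hx
    exact (mul_pos ha (Real.sqrt_pos.2 (hx1 x hx))).ne'
  · intro x hx
    have hm := hx1 x (Ioo_subset_Icc_self hx)
    have hq := hQ x hx
    have hs : 0 < √(1 - x ^ 2) := Real.sqrt_pos.2 hm
    have hss := Real.sq_sqrt hm.le
    have hsq := Real.sqrt_pos.2 hq
    set v := (a - x) / (a * √(1 - x ^ 2)) with hv
    have hv2 : 1 - v ^ 2 = (1 - x ^ 2 - (1 - a * x) ^ 2) / (a * √(1 - x ^ 2)) ^ 2 := by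
      rw [hv, eq_div_iff (by positivity), sub_mul, div_pow, div_mul_cancel₀ _ (by positivity),
        mul_pow, hss]
      ring
    have hv1 : 0 < 1 - v ^ 2 := by
      rw [hv2]
      positivity
    have hsv : √(1 - v ^ 2) = √(1 - x ^ 2 - (1 - a * x) ^ 2) / (a * √(1 - x ^ 2)) := by
      rw [hv2, Real.sqrt_div hq.le, Real.sqrt_sq (by positivity)]
    have h1 : HasDerivAt (fun x : ℝ => 1 - x ^ 2) (-(2 * x)) x := by
      simpa using (hasDerivAt_pow 2 x).const_sub 1
    have h2 := (h1.sqrt hm.ne').const_mul a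
    have h3 := ((hasDerivAt_id x).const_sub a).div h2 (by positivity)
    have h4 := (Real.hasDerivAt_arcsin (x := v) (by rintro h; rw [h] at hv1; norm_num at hv1)
      (by rintro h; rw [h] at hv1; norm_num at hv1)).comp x h3
    convert! h4.neg using 1
    rw [hsv]
    simp only [id]
    field_simp
    rw [hss]
    ring

/-- The area of the hyperball in the fundamental domain. -/
lemma area_fundDomain_inter_hyperball {a s : ℝ} (ha : 0 < a) (ha1 : a < 1) (h0 : 0 ≤ s)
    (hs : s ^ 2 ≤ 1 - a ^ 2) :
    area (fundDomain a ∩ hyperball a s) = ENNReal.ofReal (Real.artanh a * (s / √(1 - s ^ 2))) := by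
  have hs1 : s ^ 2 < 1 := by nlinarith
  have h1 : s < 1 := by nlinarith
  have hx1 : ∀ x ∈ Icc 0 a, 0 < 1 - x ^ 2 := fun x hx => by nlinarith [hx.1, hx.2]
  have hsq : ∀ x ∈ Icc 0 a, (s * √(1 - x ^ 2)) ^ 2 = s ^ 2 * (1 - x ^ 2) := fun x hx => by
    rw [mul_pow, Real.sq_sqrt (hx1 x hx).le]
  have hQ : ∀ x ∈ Icc 0 a, 1 - x ^ 2 - (s * √(1 - x ^ 2)) ^ 2 = (1 - x ^ 2) * (1 - s ^ 2) :=
    fun x hx => by rw [hsq x hx]; ring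
  have hset : fundDomain a ∩ hyperball a s = kleinDisk ∩
      {p | (0 ≤ p.1 ∧ p.1 ≤ a) ∧ 0 ≤ p.2 ∧ p.2 ≤ s * √(1 - p.1 ^ 2)} := by
    ext ⟨x, y⟩
    rw [fundDomain_eq ha ha1]
    simp only [mem_inter_iff, mem_hyperball_iff ha.ne' h0 h1, mem_ofPred_eq]
    constructor
    · rintro ⟨⟨hd, hx, hy0, hy⟩, -, h⟩
      refine ⟨hd, hx, hy0, ?_⟩
      rw [← hsq x hx] at h
      exact le_of_sq_le_sq h (mul_nonneg h0 (Real.sqrt_nonneg _))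
    · rintro ⟨hd, hx, hy0, hy⟩
      have h : y ^ 2 ≤ s ^ 2 * (1 - x ^ 2) := by
        rw [← hsq x hx]
        exact pow_le_pow_left₀ hy0 hy 2
      refine ⟨⟨hd, hx, hy0, ?_⟩, hd, h⟩
      have h2 := mul_le_mul_of_nonneg_right hs (hx1 x hx).le
      -- The tangency at P₀ again: the elliptic arc stays below the side A₀P₀, so that side imposes
      -- no further restriction.
      have h3 : (1 - a * x) ^ 2 = (1 - a ^ 2) * (1 - x ^ 2) + (a - x) ^ 2 := by ring
      have h4 : 0 ≤ 1 - a * x := by nlinarith [hx.1, hx.2]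
      exact le_of_sq_le_sq (by nlinarith [sq_nonneg (a - x)]) h4
  have hder : ∀ x ∈ Icc 0 a, HasDerivAt (fun x => Real.artanh x * (s / √(1 - s ^ 2)))
      (s * √(1 - x ^ 2) / ((1 - x ^ 2) * √(1 - x ^ 2 - (s * √(1 - x ^ 2)) ^ 2))) x := by
    intro x hx
    convert! (hasDerivAt_artanh (by linarith [hx.1]) (hx.2.trans_lt ha1)).mul_const
      (s / √(1 - s ^ 2)) using 1
    have hm := hx1 x hx
    have hp := Real.sqrt_pos.2 hm
    have hp2 : 0 < √(1 - s ^ 2) := Real.sqrt_pos.2 (by linarith)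
    rw [hQ x hx, Real.sqrt_mul hm.le]
    field_simp
  rw [area_subgraph ha hset (by fun_prop) (fun x _ => mul_nonneg h0 (Real.sqrt_nonneg _))
    (fun x hx => ?_) (fun x hx => (hder x hx).continuousAt.continuousWithinAt)
    (fun x hx => hder x (Ioo_subset_Icc_self hx))]
  · simp
  · have hx := Ioo_subset_Icc_self hx
    nlinarith [hQ x hx, mul_pos (hx1 x hx) (sub_pos.2 hs1)]

/-! ### Area of the horoball in the upper half-plane -/

/-- The isometry from the upper half-plane, with `∞` sent to `A₀`, to the Klein disk. -/
def ofHalfPlane (z : ℝ × ℝ) : ℝ × ℝ :=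
  (2 * z.1 * (1 + z.1 ^ 2 + z.2 ^ 2)⁻¹, 1 - 2 * (1 + z.1 ^ 2 + z.2 ^ 2)⁻¹)

/-- The derivative of `ofHalfPlane`. -/
def fderivOfHalfPlane (z : ℝ × ℝ) : ℝ × ℝ →L[ℝ] ℝ × ℝ :=
  (Matrix.toLin (.finTwoProd ℝ) (.finTwoProd ℝ)
    !![2 / (1 + z.1 ^ 2 + z.2 ^ 2) - 4 * z.1 ^ 2 / (1 + z.1 ^ 2 + z.2 ^ 2) ^ 2,
        -(4 * z.1 * z.2 / (1 + z.1 ^ 2 + z.2 ^ 2) ^ 2);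
      4 * z.1 / (1 + z.1 ^ 2 + z.2 ^ 2) ^ 2,
        4 * z.2 / (1 + z.1 ^ 2 + z.2 ^ 2) ^ 2]).toContinuousLinearMap

lemma hasFDerivAt_ofHalfPlane (z : ℝ × ℝ) :
    HasFDerivAt ofHalfPlane (fderivOfHalfPlane z) z := by
  have hN : (1 + z.1 ^ 2 + z.2 ^ 2) ≠ 0 := by positivity
  have h1 : HasFDerivAt (fun z : ℝ × ℝ => 1 + z.1 ^ 2 + z.2 ^ 2) _ z :=
    (((hasFDerivAt_fst (𝕜 := ℝ) (p := z)).pow 2).const_add 1).add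
      ((hasFDerivAt_snd (𝕜 := ℝ) (p := z)).pow 2)
  have h2 := (hasDerivAt_inv hN).comp_hasFDerivAt z h1
  have h3 := ((hasFDerivAt_fst (𝕜 := ℝ) (p := z)).const_mul 2).mul h2
  have h4 := (h2.const_mul 2).const_sub 1
  unfold fderivOfHalfPlane
  rw [Matrix.toLin_finTwoProd_toContinuousLinearMap]
  convert! h3.prodMk h4 using 2
  · ext <;> simp <;> field_simp <;> ring
  · ext <;> simp <;> field_simp <;> ring

lemma det_fderivOfHalfPlane (z : ℝ × ℝ) :
    (fderivOfHalfPlane z).det = 8 * z.2 / (1 + z.1 ^ 2 + z.2 ^ 2) ^ 3 := by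
  have hN : (1 + z.1 ^ 2 + z.2 ^ 2) ≠ 0 := by positivity
  unfold fderivOfHalfPlane
  simp only [LinearMap.det_toContinuousLinearMap, LinearMap.det_toLin, Matrix.det_fin_two_of]
  field_simp
  ring

lemma one_sub_ofHalfPlane (z : ℝ × ℝ) :
    1 - (ofHalfPlane z).1 ^ 2 - (ofHalfPlane z).2 ^ 2 =
      (2 * z.2 / (1 + z.1 ^ 2 + z.2 ^ 2)) ^ 2 := by
  have hN : (1 + z.1 ^ 2 + z.2 ^ 2) ≠ 0 := by positivity
  simp only [ofHalfPlane]
  field_simp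
  ring

lemma ofHalfPlane_leftInverse {z : ℝ × ℝ} (hz : 0 < z.2) :
    ((ofHalfPlane z).1 / (1 - (ofHalfPlane z).2),
      √(1 - (ofHalfPlane z).1 ^ 2 - (ofHalfPlane z).2 ^ 2) / (1 - (ofHalfPlane z).2)) = z := by
  have hN : 0 < (1 + z.1 ^ 2 + z.2 ^ 2) := by positivity
  rw [one_sub_ofHalfPlane, Real.sqrt_sq (by positivity)]
  ext
  · simp only [ofHalfPlane]
    field_simp
    ring
  · simp only [ofHalfPlane]
    field_simp
    ring

lemma injOn_ofHalfPlane : InjOn ofHalfPlane {z | 0 < z.2} := by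
  intro z hz w hw h
  rw [← ofHalfPlane_leftInverse hz, h, ofHalfPlane_leftInverse hw]

lemma ofHalfPlane_rightInverse {p : ℝ × ℝ} (hp : p ∈ kleinDisk) :
    ofHalfPlane (p.1 / (1 - p.2), √(1 - p.1 ^ 2 - p.2 ^ 2) / (1 - p.2)) = p := by
  simp only [kleinDisk, mem_ofPred_eq] at hp
  have hy : 0 < 1 - p.2 := by nlinarith [sq_nonneg p.1]
  have hN : 1 + (p.1 / (1 - p.2)) ^ 2 + (√(1 - p.1 ^ 2 - p.2 ^ 2) / (1 - p.2)) ^ 2 =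
      2 / (1 - p.2) := by
    rw [div_pow, div_pow, Real.sq_sqrt (by linarith)]
    field_simp
    ring
  simp only [ofHalfPlane]
  rw [hN]
  ext
  · simp only
    field_simp
  · simp only
    field_simp
    ring

/-- In the upper half-plane, the horoball in the fundamental domain is a vertical half-strip. -/
lemma image_ofHalfPlane {a s : ℝ} (ha : 0 < a) (ha1 : a < 1) (h0 : 0 ≤ s) (h1 : s < 1)
    (hs : 1 - 2 * a ^ 2 ≤ s) :
    ofHalfPlane '' (Icc 0 (1 / a) ×ˢ Ici (√((1 + s) / (1 - s)))) =
      fundDomain a ∩ horoball s := by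
  have hs' : 0 < 1 - s := by linarith
  have hk0 : 0 ≤ (1 + s) / (1 - s) := by positivity
  rw [fundDomain_eq ha ha1]
  ext p
  simp only [mem_inter_iff, mem_horoball_iff, mem_ofPred_eq, mem_image]
  constructor
  · rintro ⟨z, ⟨⟨hz0, hz1⟩, hz2⟩, rfl⟩
    have hk := pow_le_pow_left₀ (Real.sqrt_nonneg _) (mem_Ici.1 hz2) 2
    rw [Real.sq_sqrt hk0, div_le_iff₀ hs'] at hk
    have hz2' : 0 < z.2 := lt_of_lt_of_le (Real.sqrt_pos.2 (by positivity)) hz2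
    have haz : a * z.1 ≤ 1 := by rwa [le_div_iff₀ ha, mul_comm] at hz1
    have hd : ofHalfPlane z ∈ kleinDisk := by
      have h := one_sub_ofHalfPlane z
      have : 0 < (2 * z.2 / (1 + z.1 ^ 2 + z.2 ^ 2)) ^ 2 := by positivity
      simp only [kleinDisk, mem_ofPred_eq]
      linarith
    have hN : 0 < (1 + z.1 ^ 2 + z.2 ^ 2) := by positivity
    -- This is where `hs` enters: the half-strip lies above the top of the semicircle representing
    -- the side x = a.
    have ht : 1 ≤ z.2 ^ 2 * a ^ 2 + a ^ 2 := by
      have : 2 ≤ (1 + z.2 ^ 2) * (1 - s) := by linarith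
      nlinarith [sq_nonneg z.2]
    refine ⟨⟨hd, ⟨?_, ?_⟩, ?_, ?_⟩, hd, ?_⟩
    · simp only [ofHalfPlane]
      positivity
    · simp only [ofHalfPlane]
      rw [← div_eq_mul_inv, div_le_iff₀ hN]
      have : 0 ≤ a * (a * (1 + z.1 ^ 2 + z.2 ^ 2) - 2 * z.1) := by
        nlinarith [sq_nonneg (a * z.1 - 1)]
      linarith [nonneg_of_mul_nonneg_right this ha]
    · simp only [ofHalfPlane]
      rw [← div_eq_mul_inv, sub_nonneg, div_le_one hN]
      nlinarith [sq_nonneg z.1, sq_nonneg z.2]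
    · simp only [ofHalfPlane]
      -- The side y = 1 − ax corresponds to the vertical line z₁ = 1/a.
      have : a * (2 * z.1 * (1 + z.1 ^ 2 + z.2 ^ 2)⁻¹) =
        (a * z.1) * (2 * (1 + z.1 ^ 2 + z.2 ^ 2)⁻¹) := by ring
      rw [this]
      have h2 : 0 ≤ 2 * (1 + z.1 ^ 2 + z.2 ^ 2)⁻¹ := by positivity
      nlinarith
    · rw [one_sub_ofHalfPlane]
      have e : 1 - (ofHalfPlane z).2 = 2 / (1 + z.1 ^ 2 + z.2 ^ 2) := by
        simp only [ofHalfPlane]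
        ring
      rw [e, div_pow, div_pow, ← mul_div_assoc, ← mul_div_assoc]
      gcongr ?_ / _
      nlinarith
  · rintro ⟨⟨hd, ⟨hx0, hx1⟩, hy0, hy⟩, -, hb⟩
    refine ⟨_, ?_, ofHalfPlane_rightInverse hd⟩
    simp only [kleinDisk, mem_ofPred_eq] at hd
    have hy1 : 0 < 1 - p.2 := by nlinarith [sq_nonneg p.1]
    refine ⟨⟨div_nonneg hx0 hy1.le, ?_⟩, ?_⟩
    · simp only
      rw [div_le_div_iff₀ hy1 ha]
      linarith
    · simp only [mem_Ici]
      rw [le_div_iff₀ hy1]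
      apply Real.le_sqrt_of_sq_le
      rw [mul_pow, Real.sq_sqrt hk0, div_mul_eq_mul_div, div_le_iff₀ hs']
      linarith

lemma lintegral_Ici_sq_inv {k : ℝ} (hk : 0 < k) :
    ∫⁻ t in Ici k, ENNReal.ofReal (1 / t ^ 2) = ENNReal.ofReal (1 / k) := by
  have h : ∀ t : ℝ, 1 / t ^ 2 = t ^ (-2 : ℝ) := fun t => by
    rw [one_div, Real.rpow_neg_ofNat]
    norm_cast
  simp_rw [h]
  rw [Measure.restrict_congr_set Ioi_ae_eq_Ici.symm, ← ofReal_integral_eq_lintegral_ofReal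
    (integrableOn_Ioi_rpow_of_lt (by norm_num) hk)
    ((ae_restrict_mem measurableSet_Ioi).mono fun t ht => Real.rpow_nonneg (hk.le.trans (le_of_lt ht)) _),
    integral_Ioi_rpow_of_lt (by norm_num) hk]
  congr 1
  norm_num [Real.rpow_neg_one]

/-- The area of the horoball in the fundamental domain. -/
lemma area_fundDomain_inter_horoball {a s : ℝ} (ha : 0 < a) (ha1 : a < 1) (h0 : 0 ≤ s)
    (h1 : s < 1) (hs : 1 - 2 * a ^ 2 ≤ s) :
    area (fundDomain a ∩ horoball s) =
      ENNReal.ofReal (1 / a * (1 / √((1 + s) / (1 - s)))) := by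
  have hk : 0 < √((1 + s) / (1 - s)) := Real.sqrt_pos.2 (div_pos (by linarith) (by linarith))
  set k := √((1 + s) / (1 - s)) with hkdef
  have hRm : MeasurableSet (Icc 0 (1 / a) ×ˢ Ici k : Set (ℝ × ℝ)) :=
    measurableSet_Icc.prod measurableSet_Ici
  have hpos : ∀ z ∈ (Icc 0 (1 / a) ×ˢ Ici k : Set (ℝ × ℝ)), 0 < z.2 :=
    fun z hz => hk.trans_le hz.2
  have himg := image_ofHalfPlane ha ha1 h0 h1 hs
  have hder : ∀ z ∈ (Icc 0 (1 / a) ×ˢ Ici k : Set (ℝ × ℝ)),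
      HasFDerivWithinAt ofHalfPlane (fderivOfHalfPlane z) (Icc 0 (1 / a) ×ˢ Ici k) z :=
    fun z _ => (hasFDerivAt_ofHalfPlane z).hasFDerivWithinAt
  have hinj : InjOn ofHalfPlane (Icc 0 (1 / a) ×ˢ Ici k) := injOn_ofHalfPlane.mono hpos
  have hm : MeasurableSet (fundDomain a ∩ horoball s) := by
    rw [← himg]
    exact measurable_image_of_fderivWithin hRm hder hinj
  rw [area_apply hm (inter_subset_left.trans inter_subset_left), ← himg,
    lintegral_image_eq_lintegral_abs_det_fderiv_mul volume hRm hder hinj,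
    setLIntegral_congr_fun (g := fun z => ENNReal.ofReal (1 / z.2 ^ 2)) hRm, Measure.volume_eq_prod,
    setLIntegral_prod _ (by fun_prop)]
  · simp only [lintegral_Ici_sq_inv hk, lintegral_const, Measure.restrict_apply MeasurableSet.univ,
      univ_inter, Real.volume_Icc, sub_zero]
    rw [mul_comm, ENNReal.ofReal_mul (by positivity)]
  -- The Jacobian 8t/N³ times the Klein density (N/(2t))³ is the half-plane density 1/t², with t =
  -- `z.2`.
  · intro z hz
    have hz2 := hpos z hz
    have hN : 0 < (1 + z.1 ^ 2 + z.2 ^ 2) := by positivity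
    simp only
    rw [det_fderivOfHalfPlane, one_sub_ofHalfPlane, rpow_three_halves (by positivity),
      Real.sqrt_sq (by positivity), abs_of_pos (by positivity),
      ← ENNReal.ofReal_mul (by positivity)]
    congr 1
    field_simp
    norm_num

/-! ### Closed form of the density -/

lemma measurableSet_horoball (s : ℝ) : MeasurableSet (horoball s) := by
  have h : Continuous fun p : ℝ × ℝ =>
      (s - 1) * (-1 + p.1 ^ 2 + p.2 ^ 2) - (1 + s) * (1 - p.2) ^ 2 := by fun_prop
  exact isOpen_kleinDisk.measurableSet.inter (isClosed_le continuous_const h).measurableSet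

lemma area_line (c : ℝ) : area (univ ×ˢ {c}) = 0 := by
  refine (withDensity_absolutelyContinuous _ _).trans Measure.restrict_le_self.absolutelyContinuous ?_
  rw [Measure.volume_eq_prod, Measure.prod_prod]
  simp

/-- The density of a packing in closed form. -/
lemma density_eq {a y₁ y₂ : ℝ} (h : IsPacking a y₁ y₂) :
    density a y₁ y₂ = (1 / a * (1 / √((1 + y₁) / (1 - y₁))) +
      Real.artanh a * (y₂ / √(1 - y₂ ^ 2))) / (Real.pi / 2) := by
  obtain ⟨ha, ha1, h3, h4, h5, h8, h9, h10⟩ := isPacking_iff.1 h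
  have h6 : y₂ < 1 := h10.trans_lt h4
  have hA : 0 ≤ Real.artanh a := Real.artanh_nonneg ha.le
  have e1 : 0 ≤ 1 / a * (1 / √((1 + y₁) / (1 - y₁))) := by positivity
  have e2 : 0 ≤ Real.artanh a * (y₂ / √(1 - y₂ ^ 2)) := by positivity
  have hnull : area ((fundDomain a ∩ hyperball a y₂) ∩ (fundDomain a ∩ horoball y₁)) = 0 := by
    refine measure_mono_null ?_ (area_line y₁)
    rintro p ⟨hp, hq⟩
    exact horoball_inter_hyperball_subset ha.ne' h4 h5 h6 h10 ⟨hq.2, hp.2⟩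
  have hfm : MeasurableSet (fundDomain a) := by
    rw [fundDomain_eq ha ha1]
    exact isOpen_kleinDisk.measurableSet.inter (((measurableSet_le measurable_const
      measurable_fst).inter (measurableSet_le measurable_fst measurable_const)).inter
      ((measurableSet_le measurable_const measurable_snd).inter
      (measurableSet_le measurable_snd (by fun_prop))))
  rw [density, inter_union_distrib_left, union_comm,
    measure_union₀ (hfm.inter (measurableSet_horoball y₁)).nullMeasurableSet hnull,
    area_fundDomain_inter_hyperball ha ha1 h5 h9, area_fundDomain_inter_horoball ha ha1 h3 h4 h8,
    area_fundDomain ha ha1, ← ENNReal.ofReal_add e2 e1, ENNReal.toReal_ofReal (by positivity),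
    ENNReal.toReal_ofReal (by positivity), add_comm]

/-! ### Optimising the covered area -/

/-- The exponential `√((1 + y) / (1 - y))` of the hyperbolic distance from `A₁` to `T y`. -/
def expDist (y : ℝ) : ℝ := √((1 + y) / (1 - y))

lemma expDist_pos {y : ℝ} (h0 : 0 ≤ y) (h1 : y < 1) : 0 < expDist y :=
  Real.sqrt_pos.2 (div_pos (by linarith) (by linarith))

lemma expDist_lt {y z : ℝ} (h0 : 0 ≤ y) (h : y < z) (h1 : z < 1) : expDist y < expDist z := by
  apply Real.sqrt_lt_sqrt (div_nonneg (by linarith) (by linarith))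
  rw [div_lt_div_iff₀ (by linarith) (by linarith)]
  nlinarith

lemma sinh_eq_expDist {y : ℝ} (h0 : 0 ≤ y) (h1 : y < 1) :
    y / √(1 - y ^ 2) = (expDist y - 1 / expDist y) / 2 := by
  have hp : 0 < 1 + y := by linarith
  have hm : 0 < 1 - y := by linarith
  have hp' := Real.sqrt_pos.2 hp
  have hm' := Real.sqrt_pos.2 hm
  rw [show 1 - y ^ 2 = (1 + y) * (1 - y) by ring, expDist, Real.sqrt_mul hp.le,
    Real.sqrt_div hp.le]
  field_simp
  rw [Real.sq_sqrt hp.le, Real.sq_sqrt hm.le]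
  ring

/-- The area covered by the horoball and the hyperball in the fundamental domain. -/
def coveredArea (a y₁ y₂ : ℝ) : ℝ :=
  1 / a * (1 / expDist y₁) + Real.artanh a * (y₂ / √(1 - y₂ ^ 2))

/-- The horoball grows as its parameter falls, the hyperball as its parameter rises. -/
lemma coveredArea_lt {a y₁ y₂ z₁ z₂ : ℝ} (ha : 0 < a) (ha1 : a < 1) (hz0 : 0 ≤ z₁) (hz : z₁ ≤ y₁)
    (hy1 : y₁ < 1) (hy0 : 0 ≤ y₂) (hy : y₂ ≤ z₂) (hz1 : z₂ < 1) (hne : z₁ ≠ y₁ ∨ y₂ ≠ z₂) :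
    coveredArea a y₁ y₂ < coveredArea a z₁ z₂ := by
  have hA : 0 < Real.artanh a := Real.artanh_pos ⟨ha, ha1⟩
  have h1 : z₁ < y₁ → 1 / a * (1 / expDist y₁) < 1 / a * (1 / expDist z₁) := fun h => by
    have := expDist_pos hz0 (h.trans hy1)
    have := expDist_lt hz0 h hy1
    gcongr
  have h2 : y₂ < z₂ → Real.artanh a * (y₂ / √(1 - y₂ ^ 2)) <
      Real.artanh a * (z₂ / √(1 - z₂ ^ 2)) := fun h => by
    rw [sinh_eq_expDist hy0 (h.trans hz1), sinh_eq_expDist (hy0.trans hy) hz1]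
    have := expDist_pos hy0 (h.trans hz1)
    have := expDist_lt hy0 h hz1
    gcongr
  unfold coveredArea
  rcases hz.eq_or_lt with rfl | hz' <;> rcases hy.eq_or_lt with rfl | hy'
  · simp at hne
  · linarith [h2 hy']
  · linarith [h1 hz']
  · linarith [h1 hz', h2 hy']

/-- A function `p / r + q r` with `q > 0` has no interior maximum on an interval. -/
lemma lt_left_or_lt_right {p q r₀ r r₁ : ℝ} (hq : 0 < q) (h0 : 0 < r₀) (h01 : r₀ < r)
    (h12 : r < r₁) : p / r + q * r < p / r₀ + q * r₀ ∨ p / r + q * r < p / r₁ + q * r₁ := by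
  have hr : 0 < r := h0.trans h01
  have hr1 : 0 < r₁ := hr.trans h12
  -- The increment from r to r₁ has the sign of q r r₁ − p. If that is not positive, then p > q r r₀
  -- and moving left increases the value. No sign of p is needed.
  by_cases h : p < q * (r * r₁)
  · right
    have e : p / r₁ + q * r₁ - (p / r + q * r) = (r₁ - r) * (q * (r * r₁) - p) / (r * r₁) := by
      field_simp
      ring
    have : 0 < (r₁ - r) * (q * (r * r₁) - p) / (r * r₁) :=
      div_pos (mul_pos (by linarith) (by linarith)) (by positivity)
    linarith
  · left
    have h' : q * (r * r₀) < p := by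
      have : q * (r * r₀) < q * (r * r₁) := by
        have := h01.trans h12
        gcongr
      linarith
    have e : p / r₀ + q * r₀ - (p / r + q * r) = (r - r₀) * (p - q * (r * r₀)) / (r * r₀) := by
      field_simp
      ring
    have : 0 < (r - r₀) * (p - q * (r * r₀)) / (r * r₀) :=
      div_pos (mul_pos (by linarith) (by linarith)) (by positivity)
    linarith

lemma coveredArea_diag {a y : ℝ} (h0 : 0 ≤ y) (h1 : y < 1) : coveredArea a y y =
    (1 / a - Real.artanh a / 2) / expDist y + Real.artanh a / 2 * expDist y := by
  rw [coveredArea, sinh_eq_expDist h0 h1]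
  ring

lemma coveredArea_lt_endpoint {a y₀ y y₁ : ℝ} (ha : 0 < a) (ha1 : a < 1) (h0 : 0 ≤ y₀)
    (h01 : y₀ < y) (h12 : y < y₁) (h1 : y₁ < 1) :
    coveredArea a y y < coveredArea a y₀ y₀ ∨ coveredArea a y y < coveredArea a y₁ y₁ := by
  have hA : 0 < Real.artanh a := Real.artanh_pos ⟨ha, ha1⟩
  rw [coveredArea_diag h0 (by linarith), coveredArea_diag (by linarith) (h12.trans h1),
    coveredArea_diag (by linarith) h1]
  exact lt_left_or_lt_right (by linarith) (expDist_pos h0 (by linarith))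
    (expDist_lt h0 h01 (h12.trans h1)) (expDist_lt (by linarith) h12 h1)

/-! ### Estimates for artanh and the half-angle substitution -/

lemma le_artanh {x : ℝ} (h0 : 0 ≤ x) (h1 : x < 1) : x ≤ Real.artanh x := by
  have hder : ∀ z ∈ Ico (0 : ℝ) 1, HasDerivAt (fun z => Real.artanh z - z)
      (1 / (1 - z ^ 2) - 1) z :=
    fun z hz => (hasDerivAt_artanh (by linarith [hz.1]) hz.2).sub (hasDerivAt_id z)
  have hmono : MonotoneOn (fun z => Real.artanh z - z) (Ico 0 1) := by
    refine monotoneOn_of_deriv_nonneg (convex_Ico 0 1)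
      (fun z hz => (hder z hz).continuousAt.continuousWithinAt)
      (fun z hz => (hder z (interior_subset hz)).differentiableAt.differentiableWithinAt)
      fun z hz => ?_
    have hz := interior_subset hz
    rw [(hder z hz).deriv, sub_nonneg, le_div_iff₀ (by nlinarith [hz.1, hz.2])]
    nlinarith [sq_nonneg z]
  have := hmono (left_mem_Ico.2 one_pos) ⟨h0, h1⟩ h0
  simp only [Real.artanh_zero] at this
  linarith

/-- The right side is the cubic Taylor polynomial of the left. After division by 1 − x², the
difference has the nonnegative derivative (2/3)z⁴/(1 − z²)². -/
lemma artanh_mul_le {x : ℝ} (h0 : 0 ≤ x) (h1 : x < 1) :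
    Real.artanh x * (1 - x ^ 2) ≤ x - 2 / 3 * x ^ 3 := by
  have hpos : ∀ z ∈ Ico (0 : ℝ) 1, 0 < 1 - z ^ 2 := fun z hz => by nlinarith [hz.1, hz.2]
  have hder : ∀ z ∈ Ico (0 : ℝ) 1,
      HasDerivAt (fun z => (z - 2 / 3 * z ^ 3) / (1 - z ^ 2) - Real.artanh z)
      (2 / 3 * z ^ 4 / (1 - z ^ 2) ^ 2) z := by
    intro z hz
    have hd := hpos z hz
    have h1 := (hasDerivAt_id z).sub ((hasDerivAt_pow 3 z).const_mul (2 / 3))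
    have h2 := (h1.div ((hasDerivAt_pow 2 z).const_sub 1) hd.ne').sub
      (hasDerivAt_artanh (by linarith [hz.1]) hz.2)
    convert! h2 using 1
    simp
    field_simp
    ring
  have hmono : MonotoneOn (fun z => (z - 2 / 3 * z ^ 3) / (1 - z ^ 2) - Real.artanh z)
      (Ico 0 1) := by
    refine monotoneOn_of_deriv_nonneg (convex_Ico 0 1)
      (fun z hz => (hder z hz).continuousAt.continuousWithinAt)
      (fun z hz => (hder z (interior_subset hz)).differentiableAt.differentiableWithinAt)
      fun z hz => ?_
    rw [(hder z (interior_subset hz)).deriv]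
    positivity
  have := hmono (left_mem_Ico.2 one_pos) ⟨h0, h1⟩ h0
  simp only [Real.artanh_zero] at this
  rw [← le_div_iff₀ (hpos x ⟨h0, h1⟩)]
  norm_num at this
  linarith

lemma artanh_double {u : ℝ} (h0 : 0 ≤ u) (h1 : u < 1) :
    Real.artanh (2 * u / (1 + u ^ 2)) = 2 * Real.artanh u := by
  have hN : 0 < 1 + u ^ 2 := by positivity
  have hm : 0 < 1 - u := by linarith
  have hp : 0 < 1 + u := by linarith
  have hle : 2 * u / (1 + u ^ 2) ≤ 1 := by
    rw [div_le_one hN]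
    nlinarith [sq_nonneg (1 - u)]
  have h0' : 0 ≤ 2 * u / (1 + u ^ 2) := by positivity
  rw [Real.artanh_eq_half_log ⟨by linarith, hle⟩, Real.artanh_eq_half_log ⟨by linarith, h1.le⟩]
  have e : (1 + 2 * u / (1 + u ^ 2)) / (1 - 2 * u / (1 + u ^ 2)) = ((1 + u) / (1 - u)) ^ 2 := by
    have e1 : 1 - 2 * u / (1 + u ^ 2) = (1 - u) ^ 2 / (1 + u ^ 2) := by
      field_simp
      ring
    rw [e1]
    field_simp
    ring
  rw [e, Real.log_pow]
  push_cast
  ring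

/-- The half-angle parameter: every `0 < a < 1` is `2u / (1 + u²)` with `0 < u < 1`. -/
lemma exists_half_parameter {a : ℝ} (ha : 0 < a) (ha1 : a < 1) : ∃ u, 0 < u ∧ u < 1 ∧
    a = 2 * u / (1 + u ^ 2) ∧ √(1 - a ^ 2) = (1 - u ^ 2) / (1 + u ^ 2) := by
  have hc : 0 < 1 - a ^ 2 := by nlinarith
  set c := √(1 - a ^ 2) with hcdef
  have hc0 : 0 < c := Real.sqrt_pos.2 hc
  have hcc : c ^ 2 = 1 - a ^ 2 := Real.sq_sqrt hc.le
  have hu : 1 + (a / (1 + c)) ^ 2 = 2 / (1 + c) := by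
    field_simp
    linarith
  have hu' : 1 - (a / (1 + c)) ^ 2 = 2 * c / (1 + c) := by
    field_simp
    linarith
  refine ⟨a / (1 + c), by positivity, ?_, ?_, ?_⟩
  · rw [div_lt_one (by positivity)]
    linarith
  · rw [hu]
    field_simp
  · rw [hu, hu']
    field_simp

/-! ### Covered area at the main types -/

lemma coveredArea_type1 {a : ℝ} (ha : 0 < a) (ha1 : a < 1) :
    coveredArea a (√(1 - a ^ 2)) (√(1 - a ^ 2)) =
      (1 - √(1 - a ^ 2)) / a ^ 2 + Real.artanh a * √(1 - a ^ 2) / a := by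
  have hc : 0 < 1 - a ^ 2 := by nlinarith
  set c := √(1 - a ^ 2) with hcdef
  have hc0 : 0 < c := Real.sqrt_pos.2 hc
  have hcc : c ^ 2 = 1 - a ^ 2 := Real.sq_sqrt hc.le
  have hc1 : 0 < 1 - c := by nlinarith
  have e1 : expDist c = (1 + c) / a := by
    rw [expDist, Real.sqrt_eq_iff_mul_self_eq (by positivity) (by positivity), ← sq, div_pow,
      div_eq_div_iff hc1.ne' (by positivity)]
    have : a ^ 2 = (1 + c) * (1 - c) := by linarith
    rw [this]
    ring
  have e2 : √(1 - c ^ 2) = a := by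
    rw [hcc, sub_sub_cancel, Real.sqrt_sq ha.le]
  rw [coveredArea, e1, e2]
  have : a ^ 2 = (1 + c) * (1 - c) := by linarith
  have e3 : 1 / a * (1 / ((1 + c) / a)) = (1 - c) / a ^ 2 := by
    rw [this]
    field_simp
  rw [e3]
  ring

/-- With a = 2u/(1 + u²) the area is (1 + u²)/2 + artanh u · (1 − u²)/u ≤ 3/2 − u²/6, and a ≤ 2u. -/
lemma coveredArea_type1_le {a : ℝ} (ha : 0 < a) (ha1 : a < 1) :
    coveredArea a (√(1 - a ^ 2)) (√(1 - a ^ 2)) ≤ 3 / 2 - a ^ 2 / 24 := by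
  rw [coveredArea_type1 ha ha1]
  obtain ⟨u, hu0, hu1, hau, hcu⟩ := exists_half_parameter ha ha1
  have hN : 0 < 1 + u ^ 2 := by positivity
  have hA : Real.artanh a = 2 * Real.artanh u := by rw [hau, artanh_double hu0.le hu1]
  have hB := artanh_mul_le hu0.le hu1
  have e : (1 - √(1 - a ^ 2)) / a ^ 2 + Real.artanh a * √(1 - a ^ 2) / a =
      (1 + u ^ 2) / 2 + Real.artanh u * (1 - u ^ 2) / u := by
    rw [hA, hcu, hau]
    field_simp
    ring
  have h1 : Real.artanh u * (1 - u ^ 2) / u ≤ 1 - 2 / 3 * u ^ 2 := by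
    rw [div_le_iff₀ hu0]
    linarith
  have h2 : a ≤ 2 * u := by
    rw [hau, div_le_iff₀ hN]
    nlinarith [pow_pos hu0 3]
  have h3 : a ^ 2 ≤ (2 * u) ^ 2 := pow_le_pow_left₀ ha.le h2 2
  rw [e]
  linarith

lemma le_coveredArea_type1 {a : ℝ} (ha : 0 < a) (ha1 : a < 1) :
    1 / 2 + √(1 - a ^ 2) ≤ coveredArea a (√(1 - a ^ 2)) (√(1 - a ^ 2)) := by
  rw [coveredArea_type1 ha ha1]
  have hc : 0 < 1 - a ^ 2 := by nlinarith
  have hc0 : 0 < √(1 - a ^ 2) := Real.sqrt_pos.2 hc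
  have hcc : √(1 - a ^ 2) ^ 2 = 1 - a ^ 2 := Real.sq_sqrt hc.le
  have h1 : 1 / 2 ≤ (1 - √(1 - a ^ 2)) / a ^ 2 := by
    rw [le_div_iff₀ (by positivity)]
    nlinarith [sq_nonneg (1 - √(1 - a ^ 2))]
  have h2 : √(1 - a ^ 2) ≤ Real.artanh a * √(1 - a ^ 2) / a := by
    rw [le_div_iff₀ ha, mul_comm]
    exact mul_le_mul_of_nonneg_right (le_artanh ha.le ha1) hc0.le
  linarith

/-- Replaces the missing type 2 endpoint when 2a² > 1. In the half-angle parameter the hypothesis is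
2u + u² > 1, and the claim follows from (1 − u)(u² + 2u − 1) > 0. -/
lemma coveredArea_zero_lt_type1 {a : ℝ} (ha : 0 < a) (ha1 : a < 1) (h : 1 < 2 * a ^ 2) :
    coveredArea a 0 0 < coveredArea a (√(1 - a ^ 2)) (√(1 - a ^ 2)) := by
  rw [coveredArea_type1 ha ha1]
  have e0 : coveredArea a 0 0 = 1 / a := by simp [coveredArea, expDist]
  rw [e0]
  obtain ⟨u, hu0, hu1, hau, hcu⟩ := exists_half_parameter ha ha1
  have hN : 0 < 1 + u ^ 2 := by positivity
  have hA : Real.artanh a = 2 * Real.artanh u := by rw [hau, artanh_double hu0.le hu1]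
  have hB := le_artanh hu0.le hu1
  have hu : 1 < 2 * u + u ^ 2 := by
    rw [hau, div_pow, mul_div_assoc', lt_div_iff₀ (by positivity)] at h
    have : 0 < (2 * u + u ^ 2 - 1) * (2 * u + 1 - u ^ 2) := by nlinarith
    have h2 : 0 < 2 * u + 1 - u ^ 2 := by nlinarith
    linarith [pos_of_mul_pos_left this h2.le]
  have h1 : 1 - u ^ 2 ≤ Real.artanh u * (1 - u ^ 2) / u := by
    rw [le_div_iff₀ hu0, mul_comm]
    exact mul_le_mul_of_nonneg_right hB (by nlinarith)
  have e : (1 - √(1 - a ^ 2)) / a ^ 2 + Real.artanh a * √(1 - a ^ 2) / a =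
      (1 + u ^ 2) / 2 + Real.artanh u * (1 - u ^ 2) / u := by
    rw [hA, hcu, hau]
    field_simp
    ring
  have e1 : 1 / a = (1 + u ^ 2) / (2 * u) := by
    rw [hau, one_div_div]
  rw [e, e1]
  have h3 : (1 + u ^ 2) / (2 * u) < (1 + u ^ 2) / 2 + (1 - u ^ 2) := by
    rw [div_lt_iff₀ (by positivity)]
    nlinarith [mul_pos (sub_pos.2 hu) (sub_pos.2 hu1)]
  linarith

lemma coveredArea_type2 {a : ℝ} (ha : 0 < a) (ha1 : a < 1) :
    coveredArea a (1 - 2 * a ^ 2) (1 - 2 * a ^ 2) =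
      1 / √(1 - a ^ 2) + Real.artanh a * (1 - 2 * a ^ 2) / (2 * a * √(1 - a ^ 2)) := by
  have hc : 0 < 1 - a ^ 2 := by nlinarith
  have hc0 : 0 < √(1 - a ^ 2) := Real.sqrt_pos.2 hc
  have hcc : √(1 - a ^ 2) ^ 2 = 1 - a ^ 2 := Real.sq_sqrt hc.le
  have e1 : expDist (1 - 2 * a ^ 2) = √(1 - a ^ 2) / a := by
    rw [expDist, show (1 + (1 - 2 * a ^ 2)) / (1 - (1 - 2 * a ^ 2)) = (1 - a ^ 2) / a ^ 2 by
      field_simp; ring, Real.sqrt_div hc.le, Real.sqrt_sq ha.le]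
  have e2 : √(1 - (1 - 2 * a ^ 2) ^ 2) = 2 * a * √(1 - a ^ 2) := by
    rw [show 1 - (1 - 2 * a ^ 2) ^ 2 = (2 * a) ^ 2 * (1 - a ^ 2) by ring,
      Real.sqrt_mul (by positivity), Real.sqrt_sq (by positivity)]
  rw [coveredArea, e1, e2]
  field_simp

lemma coveredArea_type2_le {a : ℝ} (ha : 0 < a) (h : 0 ≤ 1 - 2 * a ^ 2) :
    coveredArea a (1 - 2 * a ^ 2) (1 - 2 * a ^ 2) ≤ 3 / 2 - a ^ 2 / 24 := by
  have ha1 : a < 1 := by nlinarith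
  rw [coveredArea_type2 ha ha1]
  have hc : 0 < 1 - a ^ 2 := by nlinarith
  have hA := artanh_mul_le ha.le ha1
  set c := √(1 - a ^ 2) with hcdef
  have hc0 : 0 < c := Real.sqrt_pos.2 hc
  have hcc : c ^ 2 = 1 - a ^ 2 := Real.sq_sqrt hc.le
  have haa : a ^ 2 = 1 - c ^ 2 := by linarith
  have hc1 : c < 1 := by nlinarith
  have hc7 : 7 / 10 < c := by nlinarith
  have h1 : Real.artanh a * (1 - 2 * a ^ 2) / (2 * a * c) ≤
      (1 - 2 / 3 * a ^ 2) * (1 - 2 * a ^ 2) / (2 * c ^ 3) := by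
    rw [div_le_div_iff₀ (by positivity) (by positivity)]
    have := mul_le_mul_of_nonneg_right hA (mul_nonneg h hc0.le)
    rw [← hcc] at this
    nlinarith
  have h2 : 1 / c + (1 - 2 / 3 * a ^ 2) * (1 - 2 * a ^ 2) / (2 * c ^ 3) ≤ 3 / 2 - a ^ 2 / 24 := by
    have e : 1 / c + (1 - 2 / 3 * a ^ 2) * (1 - 2 * a ^ 2) / (2 * c ^ 3) =
        (2 * c ^ 2 + (1 - 2 / 3 * a ^ 2) * (1 - 2 * a ^ 2)) / (2 * c ^ 3) := by
      field_simp
    rw [e, div_le_iff₀ (by positivity), haa]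
    -- After clearing denominators and substituting a² = 1 − c², the inequality is (1 − c) times
    -- this quartic.
    have hQ : 0 ≤ 4 + 4 * c - 20 * c ^ 2 + 15 * c ^ 3 - c ^ 4 := by
      nlinarith [mul_nonneg hc0.le (sq_nonneg (c - 4 / 5)), mul_pos (pow_pos hc0 3) (sub_pos.2 hc1),
        sq_nonneg (c - 4 / 5)]
    nlinarith [mul_nonneg (sub_pos.2 hc1).le hQ]
  linarith

lemma le_coveredArea_type2 {a : ℝ} (ha : 0 < a) (h : 0 ≤ 1 - 2 * a ^ 2) :
    3 / 2 - a ^ 2 ≤ coveredArea a (1 - 2 * a ^ 2) (1 - 2 * a ^ 2) := by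
  have ha1 : a < 1 := by nlinarith
  rw [coveredArea_type2 ha ha1]
  have hc : 0 < 1 - a ^ 2 := by nlinarith
  have hA := le_artanh ha.le ha1
  have hc0 : 0 < √(1 - a ^ 2) := Real.sqrt_pos.2 hc
  have hc1 : √(1 - a ^ 2) ≤ 1 := Real.sqrt_le_one.2 (by nlinarith)
  have h1 : 1 ≤ 1 / √(1 - a ^ 2) := by rwa [le_div_iff₀ hc0, one_mul]
  have h2 : (1 - 2 * a ^ 2) / 2 ≤ Real.artanh a * (1 - 2 * a ^ 2) / (2 * a * √(1 - a ^ 2)) := by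
    rw [div_le_div_iff₀ two_pos (by positivity)]
    have h3 := mul_le_mul_of_nonneg_right hA h
    have h4 : (1 - 2 * a ^ 2) * (a * √(1 - a ^ 2)) ≤ a * (1 - 2 * a ^ 2) := by
      nlinarith [mul_nonneg h ha.le]
    linarith
  linarith

/-! ### Comparison with the main types and density bounds -/

lemma IsPacking.density_eq {a y₁ y₂ : ℝ} (h : IsPacking a y₁ y₂) :
    density a y₁ y₂ = coveredArea a y₁ y₂ / (Real.pi / 2) :=
  HypHor.density_eq h

lemma density_lt_of_coveredArea_lt {a y₁ y₂ z₁ z₂ : ℝ} (h : IsPacking a y₁ y₂)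
    (h' : IsPacking a z₁ z₂) (hlt : coveredArea a y₁ y₂ < coveredArea a z₁ z₂) :
    density a y₁ y₂ < density a z₁ z₂ := by
  rw [h.density_eq, h'.density_eq]
  have := Real.pi_pos
  gcongr

/-- Every packing is of main type or strictly less dense than one of main type with the same
parameter. -/
lemma main_type_or_lt_main_type {a y₁ y₂ : ℝ} (h : IsPacking a y₁ y₂) :
    (y₁ = y₂ ∧ (IsType1 a y₁ ∨ IsType2 a y₁)) ∨
      ∃ y : ℝ, (IsType1 a y ∨ IsType2 a y) ∧ density a y₁ y₂ < density a y y := by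
  obtain ⟨ha, ha1, h3, h4, h5, h8, h9, h10⟩ := isPacking_iff.1 h
  have hc : 0 < 1 - a ^ 2 := by nlinarith
  have ht1 : IsType1 a (√(1 - a ^ 2)) := (isType1_iff _ _).2 ⟨ha, ha1, rfl⟩
  have hc1 : √(1 - a ^ 2) < 1 := by
    rw [Real.sqrt_lt' one_pos]
    nlinarith
  have hcc : √(1 - a ^ 2) ^ 2 = 1 - a ^ 2 := Real.sq_sqrt hc.le
  have h9' : y₂ ≤ √(1 - a ^ 2) := Real.le_sqrt_of_sq_le h9
  -- `z` is the parameter of a touching packing obtained by enlarging both parts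
  set z := max y₂ (1 - 2 * a ^ 2) with hz
  have hz0 : 0 ≤ z := h5.trans (le_max_left _ _)
  have hzy : z ≤ y₁ := max_le h10 h8
  have hz1 : z < 1 := hzy.trans_lt h4
  have hyz : y₂ ≤ z := le_max_left _ _
  have hz2 : 1 - 2 * a ^ 2 ≤ z := le_max_right _ _
  have hzc : z ≤ √(1 - a ^ 2) := by
    refine max_le h9' ?_
    rcases le_or_gt 0 (1 - 2 * a ^ 2) with hnn | hneg
    · exact Real.le_sqrt_of_sq_le (by nlinarith)
    · exact hneg.le.trans (Real.sqrt_nonneg _)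
  -- Areas are compared rather than densities, so an intermediate touching configuration need not be
  -- shown to be a packing.
  have hmain : (IsType1 a z ∨ IsType2 a z) ∨
      ∃ y : ℝ, (IsType1 a y ∨ IsType2 a y) ∧ coveredArea a z z < coveredArea a y y := by
    rcases hzc.eq_or_lt with hzc' | hzc'
    · exact Or.inl (Or.inl (hzc' ▸ ht1))
    rcases le_or_gt 0 (1 - 2 * a ^ 2) with hnn | hneg
    · have ht2 : IsType2 a (1 - 2 * a ^ 2) :=
        (isType2_iff _ _).2 ⟨ha, (le_one_div_sqrt_two_iff ha).2 hnn, rfl⟩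
      rcases hz2.eq_or_lt with hz2' | hz2'
      · exact Or.inl (Or.inr (hz2' ▸ ht2))
      · rcases coveredArea_lt_endpoint ha ha1 hnn hz2' hzc' hc1 with hl | hr
        · exact Or.inr ⟨_, Or.inr ht2, hl⟩
        · exact Or.inr ⟨_, Or.inl ht1, hr⟩
    · have hzero := coveredArea_zero_lt_type1 ha ha1 (by linarith)
      refine Or.inr ⟨_, Or.inl ht1, ?_⟩
      rcases hz0.eq_or_lt with hz0' | hz0'
      · rwa [← hz0']
      · rcases coveredArea_lt_endpoint ha ha1 le_rfl hz0' hzc' hc1 with hl | hr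
        · exact hl.trans hzero
        · exact hr
  by_cases hne : z ≠ y₁ ∨ y₂ ≠ z
  · have hlt := coveredArea_lt ha ha1 hz0 hzy h4 h5 hyz hz1 hne
    right
    rcases hmain with ht | ⟨y, ht, hy⟩
    · exact ⟨z, ht, density_lt_of_coveredArea_lt h (ht.elim (·.1) (·.1)) hlt⟩
    · exact ⟨y, ht, density_lt_of_coveredArea_lt h (ht.elim (·.1) (·.1)) (hlt.trans hy)⟩
  · push Not at hne
    obtain ⟨e1, e2⟩ := hne
    rcases hmain with ht | ⟨y, ht, hy⟩
    · left
      rw [← e1]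
      exact ⟨e2.symm, ht⟩
    · right
      refine ⟨y, ht, density_lt_of_coveredArea_lt h (ht.elim (·.1) (·.1)) ?_⟩
      rwa [← e1, e2]

lemma density_main_type_le {a y : ℝ} (h : IsType1 a y ∨ IsType2 a y) :
    density a y y ≤ 3 / Real.pi - a ^ 2 / (12 * Real.pi) := by
  have hpi := Real.pi_pos
  have e : 3 / Real.pi - a ^ 2 / (12 * Real.pi) = (3 / 2 - a ^ 2 / 24) / (Real.pi / 2) := by
    field_simp
    ring
  rw [(h.elim (·.1) (·.1) : IsPacking a y y).density_eq, e]
  gcongr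
  rcases h with h | h
  · obtain ⟨ha, ha1, rfl⟩ := (isType1_iff _ _).1 h
    exact coveredArea_type1_le ha ha1
  · obtain ⟨ha, ha2, rfl⟩ := (isType2_iff _ _).1 h
    exact coveredArea_type2_le ha ((le_one_div_sqrt_two_iff ha).1 ha2)

lemma IsPacking.density_le {a y₁ y₂ : ℝ} (h : IsPacking a y₁ y₂) :
    density a y₁ y₂ ≤ 3 / Real.pi - a ^ 2 / (12 * Real.pi) := by
  rcases main_type_or_lt_main_type h with ⟨rfl, ht⟩ | ⟨y, ht, hlt⟩
  · exact density_main_type_le ht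
  · exact hlt.le.trans (density_main_type_le ht)

lemma IsPacking.density_lt {a y₁ y₂ : ℝ} (h : IsPacking a y₁ y₂) :
    density a y₁ y₂ < 3 / Real.pi := by
  have ha := h.a_pos
  have : 0 < a ^ 2 / (12 * Real.pi) := by positivity
  linarith [h.density_le]

/-- Squeeze: the universal bound 3/π serves as upper bound, so only a lower bound for the covered
area is required. -/
lemma tendsto_density_of_le {y b : ℝ → ℝ} (hb : Tendsto b (𝓝[>] 0) (𝓝 (3 / 2)))
    (hp : ∀ᶠ a in 𝓝[>] 0, IsPacking a (y a) (y a) ∧ b a ≤ coveredArea a (y a) (y a)) :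
    Tendsto (fun a => density a (y a) (y a)) (𝓝[>] 0) (𝓝 (3 / Real.pi)) := by
  have hpi := Real.pi_pos
  have e : 3 / 2 / (Real.pi / 2) = 3 / Real.pi := by field_simp
  refine tendsto_of_tendsto_of_tendsto_of_le_of_le' (e ▸ hb.div_const (Real.pi / 2))
    tendsto_const_nhds (hp.mono fun a h => ?_) (hp.mono fun a h => h.1.density_lt.le)
  rw [h.1.density_eq]
  have := h.2
  gcongr

end HypHor

end

theorem theorem4p6 :
    (∀ a y : ℝ, HypHor.IsType1 a y ↔ 0 < a ∧ a < 1 ∧ y = Real.sqrt (1 - a ^ 2)) ∧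
    (∀ a y : ℝ, HypHor.IsType2 a y ↔ 0 < a ∧ a ≤ 1 / Real.sqrt 2 ∧ y = 1 - 2 * a ^ 2) ∧
    (∀ a y₁ y₂ : ℝ, HypHor.IsPacking a y₁ y₂ →
      (y₁ = y₂ ∧ (HypHor.IsType1 a y₁ ∨ HypHor.IsType2 a y₁)) ∨
      ∃ y : ℝ, (HypHor.IsType1 a y ∨ HypHor.IsType2 a y) ∧
        HypHor.density a y₁ y₂ < HypHor.density a y y) ∧
    (∀ a y₁ y₂ : ℝ, HypHor.IsPacking a y₁ y₂ → HypHor.density a y₁ y₂ < 3 / Real.pi) ∧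
    (∀ ε : ℝ, 0 < ε → ∃ η : ℝ, 0 < η ∧ ∀ a y₁ y₂ : ℝ, HypHor.IsPacking a y₁ y₂ → ε ≤ a →
      HypHor.density a y₁ y₂ ≤ 3 / Real.pi - η) ∧
    Tendsto (fun a : ℝ => HypHor.density a (Real.sqrt (1 - a ^ 2)) (Real.sqrt (1 - a ^ 2)))
      (𝓝[>] 0) (𝓝 (3 / Real.pi)) ∧
    Tendsto (fun a : ℝ => HypHor.density a (1 - 2 * a ^ 2) (1 - 2 * a ^ 2))
      (𝓝[>] 0) (𝓝 (3 / Real.pi)) := by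
  refine ⟨HypHor.isType1_iff, HypHor.isType2_iff, fun a y₁ y₂ h =>
    HypHor.main_type_or_lt_main_type h, fun a y₁ y₂ h => h.density_lt, fun ε hε => ?_, ?_, ?_⟩
  · refine ⟨ε ^ 2 / (12 * Real.pi), by positivity, fun a y₁ y₂ h hle => ?_⟩
    have : ε ^ 2 / (12 * Real.pi) ≤ a ^ 2 / (12 * Real.pi) := by gcongr
    linarith [h.density_le]
  · refine HypHor.tendsto_density_of_le (b := fun a => 1 / 2 + √(1 - a ^ 2)) ?_ ?_
    · have : ContinuousAt (fun a : ℝ => 1 / 2 + √(1 - a ^ 2)) 0 := by fun_prop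
      convert! this.tendsto.mono_left nhdsWithin_le_nhds using 2
      norm_num
    · filter_upwards [Ioo_mem_nhdsGT one_pos] with a ha
      exact ⟨((HypHor.isType1_iff _ _).2 ⟨ha.1, ha.2, rfl⟩).1,
        HypHor.le_coveredArea_type1 ha.1 ha.2⟩
  · refine HypHor.tendsto_density_of_le (b := fun a => 3 / 2 - a ^ 2) ?_ ?_
    · have : ContinuousAt (fun a : ℝ => 3 / 2 - a ^ 2) 0 := by fun_prop
      convert! this.tendsto.mono_left nhdsWithin_le_nhds using 2
      norm_num
    · filter_upwards [Ioo_mem_nhdsGT (one_half_pos (α := ℝ))] with a ha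
      have h : 0 ≤ 1 - 2 * a ^ 2 := by nlinarith [ha.1, ha.2]
      exact ⟨((HypHor.isType2_iff _ _).2
        ⟨ha.1, (HypHor.le_one_div_sqrt_two_iff ha.1).2 h, rfl⟩).1,
        HypHor.le_coveredArea_type2 ha.1 h⟩
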